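/- For sequences $\delta=(\delta_1,\dots,\delta_n)$, $\Delta=(\Delta_1,\dots,\Delta_n)$ of non-negative integers with $\sum_i\delta_i=\sum_i\Delta_i=m$, let $g(\delta,\Delta)$ be the number of simple digraphs (no loops and no multiple arcs; opposite arcs $u\to v$, $v\to u$ are allowed) on the vertex set $\{1,\dots,n\}$ in which vertex $i$ has in-degree $\delta_i$ and out-degree $\Delta_i$ for every $i$. Let $D=\max\{\max_i\delta_i,\max_j\Delta_j\}$ and $(d)_2=d(d-1)$. (a) Always $$g(\delta,\Delta)\le m!\prod_{i=1}^n\frac1{\delta_i!\,\Delta_i!}.$$ (b) If $m\ge n$ and $D=o(m^{1/4})$, then $$g(\delta,\Delta)=m!\left(\prod_{i=1}^n\frac1{\delta_i!\,\Delta_i!}\right)\exp\left(-\frac1m\sum_i\delta_i\Delta_i-\frac1{2m^2}\sum_i(\delta_i)_2\sum_j(\Delta_j)_2+O(D^4/m)\right).$$ Here the constant implied by $O$ is absolute. That is, there is a constant $C>0$ such that for every sequence (indexed by $k\in\mathbb N$) of data $n_k$, $m_k\ge n_k$, $\delta^{(k)},\Delta^{(k)}\in\mathbb Z_{\ge0}^{n_k}$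 with all component sums of $\delta^{(k)}$ and of $\Delta^{(k)}$ equal to $m_k$ and with $D_k=o(m_k^{1/4})$ as $k\to\infty$, for all sufficiently large $k$ the formula holds with a remainder $\theta_k$ in place of $O(D^4/m)$ satisfying $|\theta_k|\le C\,D_k^4/m_k$. (For $n=m=0$, all quotients with denominator $m$ are read as $0$.) -/

import Mathlib

open Asymptotics Filter

/-- In-degree of the vertex `v`: the number of arcs `u → v` of the digraph `G`. -/
noncomputable def Digraph.inDeg {V : Type*} (G : Digraph V) (v : V) : ℕ :=
  {u : V | G.Adj u v}.ncard

/-- Out-degree of the vertex `v`: the number of arcs `v → u` of the digraph `G`. -/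
noncomputable def Digraph.outDeg {V : Type*} (G : Digraph V) (v : V) : ℕ :=
  {u : V | G.Adj v u}.ncard

/-- The number `g(δ, Δ)` of simple digraphs on the labelled vertex set `Fin n` with in-degrees `δ i`
and out-degrees `Δ i`. A `Digraph` never has multiple arcs, so "simple" only has to exclude loops;
a pair of opposite arcs `u → v`, `v → u` is allowed. -/
noncomputable def simpleDigraphCount {n : ℕ} (δ Δ : Fin n → ℕ) : ℕ :=
  {G : Digraph (Fin n) | (∀ v, ¬ G.Adj v v) ∧
    (∀ v, G.inDeg v = δ v) ∧ (∀ v, G.outDeg v = Δ v)}.ncard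

/-- `D = max {max_i δ_i, max_j Δ_j}`. -/
def maxDegree {n : ℕ} (δ Δ : Fin n → ℕ) : ℕ :=
  max (Finset.univ.sup δ) (Finset.univ.sup Δ)

/-- The factor `m! ∏_i 1 / (δ_i! Δ_i!)`. -/
noncomputable def mainFactor (m : ℕ) {n : ℕ} (δ Δ : Fin n → ℕ) : ℝ :=
  (m.factorial : ℝ) * ∏ i, (1 / (((δ i).factorial : ℝ) * ((Δ i).factorial : ℝ)))

/-- The explicit part of the exponent,
`-(1/m) ∑_i δ_i Δ_i - (1/(2m²)) ∑_i (δ_i)_2 ∑_j (Δ_j)_2`, where `(d)_2 = d (d - 1)`. -/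
noncomputable def mainExponent (m : ℕ) {n : ℕ} (δ Δ : Fin n → ℕ) : ℝ :=
  -(1 / (m : ℝ)) * ∑ i, (δ i : ℝ) * (Δ i : ℝ)
    - 1 / (2 * (m : ℝ) ^ 2)
      * ((∑ i, (δ i : ℝ) * ((δ i : ℝ) - 1)) * ∑ j, (Δ j : ℝ) * ((Δ j : ℝ) - 1))

/-!
A simple digraph is a family of in-neighbourhoods `S v ⊆ V` with `v ∉ S v`, that is, a bipartite
simple graph with rows and columns of prescribed degrees `δ`, `Δ` and some forbidden edges
(`rowGraphs`). Add `m` spare rows of degree zero, and move the `m` edges one at a time from the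
original rows to distinct spare rows. At the end all rows have degree at most one and nothing is
forbidden there, so the graphs are counted exactly by the multinomial coefficient
`m! / ∏ Δ_j!` (`card_rowGraphs_of_le_one`).

One such move, from the row `a` to the spare row `b`, is reversible: contracting `b` into `a` is a
bijection from the graphs in which the neighbour of `b` is neither a neighbour of `a` nor forbidden
at `a` onto the graphs with original degrees and a distinguished edge at `a`
(`card_filter_splitRow`). Hence the normalized count `g ∏ δ_i! ∏ Δ_j! / m!` is multiplied, at each
step back, by `1 - q`, where `q` is the probability of a collision of `b` with `a` in a random graph
with the split degrees. As `1 - q ≤ 1`, this already gives the upper bound (`card_rowGraphs_le`).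

For the asymptotics, `q` is computed with absolute error `O(D⁴ / m²)` by switchings that replace
edges `(p, y)`, `(u, v)` by `(p, v)`, `(u, y)`. Switching at `p = b` turns `q` into `1 / m` times the
expected number of edges off `a` that end in the closed neighbourhood of `a` (`collisions_upper`,
`collisions_lower`); switching at `p = a` evaluates that expectation (`neighbour_weight_estimate`);
the switchings at `b` that fail are few by one further switching (`obstructions_upper`). The result
is `q = Δ_a / m + (δ_a - 1) ∑ (Δ_j)_2 / m² + O(D⁴ / m²)`, which is exactly the change of the
explicit exponent under the move, up to the error (`rowExponent_splitRow`). Since `q = O(D² / m)`,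
passing from `1 - q` to an exponential costs another `O(D⁴ / m²)`, and the `m` steps together cost
`O(D⁴ / m)` (`card_rowGraphs_asymptotic`).
-/

section RowModel

open Finset

set_option linter.unusedSectionVars false

variable {ι J : Type*} [Fintype ι] [DecidableEq ι] [Fintype J] [DecidableEq J]

/-! ### Bipartite graphs with prescribed degrees -/

/-- Bipartite simple graphs between `ι` and `J`, encoded by the neighbourhood `S i ⊆ J` of each
row `i`, with row degrees `δ`, column degrees `Δ`, and without the forbidden edges `(i, j)`,
`j ∈ F i`. Simple digraphs are the case of in-neighbourhoods with `F v = {v}`. -/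
def rowGraphs (F : ι → Finset J) (δ : ι → ℕ) (Δ : J → ℕ) : Finset (ι → Finset J) :=
  {S | (∀ i, #(S i) = δ i) ∧ (∀ i, Disjoint (S i) (F i)) ∧ ∀ j, #{i | j ∈ S i} = Δ j}

/-- The degree sequence after one edge of the row `a` has been moved to the empty row `b`. -/
def splitRow (δ : ι → ℕ) (a b : ι) : ι → ℕ :=
  Function.update (Function.update δ a (δ a - 1)) b 1

/-- The switching that replaces the edges `(p, y)`, `(u, v)` by `(p, v)`, `(u, y)`. -/
def switchEdges (S : ι → Finset J) (p : ι) (y : J) (u : ι) (v : J) : ι → Finset J :=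
  Function.update (Function.update S p (insert v ((S p).erase y))) u (insert y ((S u).erase v))

variable {F : ι → Finset J} {δ : ι → ℕ} {Δ : J → ℕ} {S : ι → Finset J}


lemma mem_rowGraphs : S ∈ rowGraphs F δ Δ ↔
    (∀ i, #(S i) = δ i) ∧ (∀ i, Disjoint (S i) (F i)) ∧ ∀ j, #{i | j ∈ S i} = Δ j := by
  simp [rowGraphs]

lemma sum_eq_sum_of_eq_off_pair {f g : ι → ℕ} {p u : ι} (hpu : p ≠ u)
    (h : ∀ i, i ≠ p → i ≠ u → f i = g i) (h2 : f p + f u = g p + g u) :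
    ∑ i, f i = ∑ i, g i := by
  have key : ∀ k : ι → ℕ, ∑ i, k i = k p + k u + ∑ i ∈ (univ.erase p).erase u, k i := by
    intro k
    rw [← add_sum_erase univ k (mem_univ p),
      ← add_sum_erase (univ.erase p) k (mem_erase.2 ⟨hpu.symm, mem_univ u⟩), add_assoc]
  rw [key f, key g, h2]
  congr 1
  refine sum_congr rfl fun i hi => ?_
  simp only [mem_erase, mem_univ, and_true] at hi
  exact h i hi.2 hi.1

lemma column_card_eq_of_eq_off_pair {T : ι → Finset J} {p u : ι} {j : J} (hpu : p ≠ u)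
    (h : ∀ i, i ≠ p → i ≠ u → T i = S i)
    (h2 : (if j ∈ T p then 1 else 0) + (if j ∈ T u then 1 else 0)
      = (if j ∈ S p then 1 else 0) + (if j ∈ S u then 1 else 0)) :
    #{i | j ∈ T i} = #{i | j ∈ S i} := by
  rw [card_filter, card_filter]
  exact sum_eq_sum_of_eq_off_pair hpu (fun i hp hu => by rw [h i hp hu]) h2

/-! ### Edge counts -/

lemma sum_edges_column (hS : S ∈ rowGraphs F δ Δ) (w : J → ℕ) :
    ∑ u, ∑ v ∈ S u, w v = ∑ v, Δ v * w v := by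
  have : ∀ u, ∑ v ∈ S u, w v = ∑ v, if v ∈ S u then w v else 0 := by
    intro u; rw [← sum_filter]; simp
  simp_rw [this]
  rw [sum_comm]
  refine sum_congr rfl fun v _ => ?_
  rw [← sum_filter, sum_const, (mem_rowGraphs.1 hS).2.2 v, smul_eq_mul]

lemma sum_edges_row (hS : S ∈ rowGraphs F δ Δ) (w : ι → ℕ) :
    ∑ u, ∑ _v ∈ S u, w u = ∑ u, δ u * w u := by
  refine sum_congr rfl fun u _ => ?_
  rw [sum_const, (mem_rowGraphs.1 hS).1 u, smul_eq_mul]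

/-! ### Switchings -/

lemma switchEdges_left {p u : ι} (hpu : p ≠ u) (y v : J) :
    switchEdges S p y u v p = insert v ((S p).erase y) := by
  simp [switchEdges, hpu]

lemma switchEdges_right (p u : ι) (y v : J) :
    switchEdges S p y u v u = insert y ((S u).erase v) := by
  simp [switchEdges]

lemma switchEdges_of_ne {p u i : ι} (hp : i ≠ p) (hu : i ≠ u) (y v : J) :
    switchEdges S p y u v i = S i := by
  simp [switchEdges, hp, hu]

lemma switchEdges_mem {p u : ι} {y v : J} (hS : S ∈ rowGraphs F δ Δ) (hy : y ∈ S p) (hv : v ∈ S u)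
    (hvp : v ∉ S p ∪ F p) (hyu : y ∉ S u ∪ F u) : switchEdges S p y u v ∈ rowGraphs F δ Δ := by
  rw [mem_union, not_or] at hvp hyu
  have hpu : p ≠ u := by rintro rfl; exact hyu.1 hy
  have hyv : y ≠ v := by rintro rfl; exact hyu.1 hv
  obtain ⟨h1, h2, h3⟩ := mem_rowGraphs.1 hS
  refine mem_rowGraphs.2 ⟨fun i => ?_, fun i => ?_, fun j => ?_⟩
  · rw [← h1 i]
    by_cases hp : i = p
    · subst hp
      rw [switchEdges_left hpu, card_insert_of_notMem (by simp [hvp.1]), card_erase_add_one hy]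
    by_cases hu : i = u
    · subst hu
      rw [switchEdges_right, card_insert_of_notMem (by simp [hyu.1]), card_erase_add_one hv]
    rw [switchEdges_of_ne hp hu]
  · by_cases hp : i = p
    · subst hp
      rw [switchEdges_left hpu, disjoint_insert_left]
      exact ⟨hvp.2, disjoint_of_subset_left (erase_subset _ _) (h2 i)⟩
    by_cases hu : i = u
    · subst hu
      rw [switchEdges_right, disjoint_insert_left]
      exact ⟨hyu.2, disjoint_of_subset_left (erase_subset _ _) (h2 i)⟩
    rw [switchEdges_of_ne hp hu]
    exact h2 i
  · rw [← h3 j]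
    refine column_card_eq_of_eq_off_pair hpu (fun i hp hu => switchEdges_of_ne hp hu _ _) ?_
    rw [switchEdges_left hpu, switchEdges_right]
    by_cases hjy : j = y
    · subst hjy
      simp [hy, hyu.1, hyv]
    by_cases hjv : j = v
    · subst hjv
      simp [hv, hvp.1, hyv.symm]
    simp [hjy, hjv]

lemma switchEdges_switchEdges {p u : ι} {y v : J} (hy : y ∈ S p) (hv : v ∈ S u)
    (hvp : v ∉ S p) (hyu : y ∉ S u) :
    switchEdges (switchEdges S p y u v) p v u y = S := by
  have hpu : p ≠ u := by rintro rfl; exact hyu hy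
  funext i
  by_cases hp : i = p
  · subst hp
    rw [switchEdges_left hpu, switchEdges_left hpu, erase_insert (by simp [hvp]), insert_erase hy]
  by_cases hu : i = u
  · subst hu
    rw [switchEdges_right, switchEdges_right, erase_insert (by simp [hyu]), insert_erase hv]
  rw [switchEdges_of_ne hp hu, switchEdges_of_ne hp hu]

/-- All `(S, y, u, v)` with `S ∈ G`, an edge `(p, y)` of `S` at the row `p`, and an arbitrary edge
`(u, v)` of `S`. -/
def edgePairs (G : Finset (ι → Finset J)) (p : ι) : Finset ((ι → Finset J) × J × ι × J) :=
  (G ×ˢ univ ×ˢ univ ×ˢ univ).filter fun t => t.2.1 ∈ t.1 p ∧ t.2.2.2 ∈ t.1 t.2.2.1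

/-- The members of `edgePairs` at which the switching creates neither a multiple nor a forbidden
edge. -/
def validPairs (F : ι → Finset J) (G : Finset (ι → Finset J)) (p : ι) :
    Finset ((ι → Finset J) × J × ι × J) :=
  (edgePairs G p).filter fun t =>
    t.2.2.2 ∉ t.1 p ∪ F p ∧ t.2.1 ∉ t.1 t.2.2.1 ∪ F t.2.2.1

lemma sum_edgePairs (G : Finset (ι → Finset J)) (p : ι) (φ : (ι → Finset J) × J × ι × J → ℕ) :
    ∑ t ∈ edgePairs G p, φ t = ∑ S ∈ G, ∑ y ∈ S p, ∑ u, ∑ v ∈ S u, φ (S, y, u, v) := by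
  rw [edgePairs, sum_filter, sum_product]
  refine sum_congr rfl fun S _ => ?_
  rw [sum_product]
  have : ∀ k : J → ℕ, ∑ y ∈ S p, k y = ∑ y, if y ∈ S p then k y else 0 := by
    intro k; rw [← sum_filter]; simp
  rw [this]
  refine sum_congr rfl fun y _ => ?_
  rw [sum_product]
  by_cases hy : y ∈ S p
  · simp only [hy, true_and, if_true]
    refine sum_congr rfl fun u _ => ?_
    rw [← sum_filter]; simp
  · simp [hy]

/-- The switching permutes the valid pairs, exchanging the two columns. -/
lemma sum_validPairs_switch (p : ι) (φ : (ι → Finset J) × J × ι × J → ℕ) :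
    ∑ t ∈ validPairs F (rowGraphs F δ Δ) p, φ t
      = ∑ t ∈ validPairs F (rowGraphs F δ Δ) p,
          φ (switchEdges t.1 p t.2.1 t.2.2.1 t.2.2.2, t.2.2.2, t.2.2.1, t.2.1) := by
  have hmaps : ∀ t ∈ validPairs F (rowGraphs F δ Δ) p,
      (switchEdges t.1 p t.2.1 t.2.2.1 t.2.2.2, t.2.2.2, t.2.2.1, t.2.1)
        ∈ validPairs F (rowGraphs F δ Δ) p := by
    rintro ⟨S, y, u, v⟩ ht
    simp only [validPairs, edgePairs, mem_filter, mem_product, mem_univ, and_true] at ht ⊢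
    obtain ⟨⟨hS, hy, hv⟩, hvp, hyu⟩ := ht
    have hpu : p ≠ u := by rintro rfl; exact hyu (mem_union_left _ hy)
    have hyv : y ≠ v := by rintro rfl; exact hyu (mem_union_left _ hv)
    have hd := (mem_rowGraphs.1 hS).2.1
    refine ⟨⟨switchEdges_mem hS hy hv hvp hyu, ?_, ?_⟩, ?_, ?_⟩
    · simp [switchEdges_left hpu]
    · simp [switchEdges_right]
    · simp [switchEdges_left hpu, hyv, disjoint_left.1 (hd p) hy]
    · simp [switchEdges_right, hyv.symm, disjoint_left.1 (hd u) hv]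
  have hinv : ∀ t ∈ validPairs F (rowGraphs F δ Δ) p,
      switchEdges (switchEdges t.1 p t.2.1 t.2.2.1 t.2.2.2) p t.2.2.2 t.2.2.1 t.2.1 = t.1 := by
    rintro ⟨S, y, u, v⟩ ht
    simp only [validPairs, edgePairs, mem_filter, mem_product, mem_univ, and_true,
      mem_union, not_or] at ht ⊢
    exact switchEdges_switchEdges ht.1.2.1 ht.1.2.2 ht.2.1.1 ht.2.2.1
  refine sum_nbij' (fun t => (switchEdges t.1 p t.2.1 t.2.2.1 t.2.2.2, t.2.2.2, t.2.2.1, t.2.1))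
    (fun t => (switchEdges t.1 p t.2.1 t.2.2.1 t.2.2.2, t.2.2.2, t.2.2.1, t.2.1))
    hmaps hmaps ?_ ?_ ?_
  · intro t ht
    simp only [hinv t ht]
  · intro t ht
    simp only [hinv t ht]
  · intro t ht
    simp only [hinv t ht]

/-! ### Moving an edge to an empty row -/

/-- Contracting the row `b`, of degree one, into the row `a`: the graphs with split degrees for which
this creates neither a multiple nor a forbidden edge are the graphs with the original degrees
together with a distinguished edge at `a`. -/
lemma card_filter_splitRow {a b : ι} (hab : a ≠ b) (ha : δ a ≠ 0) (hb : δ b = 0) (hF : F b = ∅) :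
    #{S ∈ rowGraphs F (splitRow δ a b) Δ | Disjoint (S b) (S a ∪ F a)}
      = δ a * #(rowGraphs F δ Δ) := by
  have hcard : #(((rowGraphs F δ Δ) ×ˢ (univ : Finset J)).filter fun t => t.2 ∈ t.1 a)
      = δ a * #(rowGraphs F δ Δ) := by
    rw [card_filter, sum_product]
    have : ∀ S ∈ rowGraphs F δ Δ, (∑ y, if y ∈ S a then 1 else 0) = δ a := by
      intro S hS
      rw [← card_filter, ← (mem_rowGraphs.1 hS).1 a]; simp
    rw [sum_congr rfl this, sum_const, smul_eq_mul, mul_comm]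
  rw [← hcard]
  symm
  refine card_bij
    (fun t _ => Function.update (Function.update t.1 a (t.1 a |>.erase t.2)) b {t.2}) ?_ ?_ ?_
  · rintro ⟨S, y⟩ ht
    simp only [mem_filter, mem_product, mem_univ, and_true] at ht ⊢
    obtain ⟨hS, hy⟩ := ht
    obtain ⟨h1, h2, h3⟩ := mem_rowGraphs.1 hS
    have hSb : S b = ∅ := by rw [← card_eq_zero, h1, hb]
    refine ⟨mem_rowGraphs.2 ⟨fun i => ?_, fun i => ?_, fun j => ?_⟩, ?_⟩
    · by_cases hib : i = b
      · subst hib; simp [splitRow]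
      by_cases hia : i = a
      · subst hia; simp [splitRow, hib, card_erase_of_mem hy, h1]
      simp [splitRow, hib, hia, h1]
    · by_cases hib : i = b
      · subst hib; simp [hF]
      by_cases hia : i = a
      · subst hia
        simpa [hib] using disjoint_of_subset_left (erase_subset _ _) (h2 i)
      simpa [hib, hia] using h2 i
    · rw [← h3 j]
      refine column_card_eq_of_eq_off_pair hab (fun i hp hu => by simp [hp, hu]) ?_
      by_cases hj : j = y
      · subst hj; simp [hab, hSb, hy]
      · simp [hab, hSb, hj]
    · simp [hab, disjoint_left.1 (h2 a) hy]
  · rintro ⟨S, y⟩ ht ⟨T, z⟩ ht' h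
    simp only [mem_filter, mem_product, mem_univ, and_true] at ht ht' h
    have hyz : y = z := by simpa using congrFun h b
    subst hyz
    refine Prod.ext (funext fun i => ?_) rfl
    have hi := congrFun h i
    by_cases hib : i = b
    · subst hib
      have e1 : S i = ∅ := by rw [← card_eq_zero, (mem_rowGraphs.1 ht.1).1, hb]
      have e2 : T i = ∅ := by rw [← card_eq_zero, (mem_rowGraphs.1 ht'.1).1, hb]
      simp [e1, e2]
    by_cases hia : i = a
    · subst hia
      simp only [ne_eq, hib, not_false_eq_true, Function.update_of_ne, Function.update_self] at hi
      change S i = T i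
      rw [← insert_erase ht.2, hi, insert_erase ht'.2]
    simpa [hib, hia] using hi
  · intro T hT
    simp only [mem_filter] at hT
    obtain ⟨hT, hd⟩ := hT
    obtain ⟨h1, h2, h3⟩ := mem_rowGraphs.1 hT
    obtain ⟨y, hy⟩ := card_eq_one.1 (show #(T b) = 1 by rw [h1]; simp [splitRow])
    have hTa : #(T a) = δ a - 1 := by rw [h1]; simp [splitRow, hab]
    rw [hy, disjoint_singleton_left, mem_union, not_or] at hd
    refine ⟨(Function.update (Function.update T a (insert y (T a))) b ∅, y), ?_, ?_⟩
    · simp only [mem_filter, mem_product, mem_univ, and_true]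
      refine ⟨mem_rowGraphs.2 ⟨fun i => ?_, fun i => ?_, fun j => ?_⟩, by simp [hab]⟩
      · by_cases hib : i = b
        · subst hib; simp [hb]
        by_cases hia : i = a
        · subst hia
          simp only [ne_eq, hib, not_false_eq_true, Function.update_of_ne, Function.update_self]
          rw [card_insert_of_notMem hd.1, hTa]; omega
        simp [hib, hia, h1, splitRow]
      · by_cases hib : i = b
        · subst hib; simp
        by_cases hia : i = a
        · subst hia
          simp [hib, disjoint_insert_left, hd.2, h2]
        simpa [hib, hia] using h2 i
      · rw [← h3 j]
        refine column_card_eq_of_eq_off_pair hab (fun i hp hu => by simp [hp, hu]) ?_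
        by_cases hj : j = y
        · subst hj; simp [hab, hy, hd.1]
        · simp [hab, hy, hj]
    · funext i
      by_cases hib : i = b
      · subst hib; simp [hy]
      by_cases hia : i = a
      · subst hia; simp [hib, hd.1]
      simp [hib, hia]

/-! ### Rows of degree at most one -/

lemma card_fiber_singleton {b : ι} {j : J} (hb : δ b = 1) (hF : F b = ∅) (hj : Δ j ≠ 0) :
    #{S ∈ rowGraphs F δ Δ | S b = {j}}
      = #(rowGraphs F (Function.update δ b 0) (Function.update Δ j (Δ j - 1))) := by
  have hcol : ∀ (S : ι → Finset J) (k : J), #{i | k ∈ S i}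
      = (if k ∈ S b then 1 else 0) + ∑ i ∈ univ.erase b, if k ∈ S i then 1 else 0 := by
    intro S k
    rw [card_filter, ← add_sum_erase univ _ (mem_univ b)]
  have hcol' : ∀ (S : ι → Finset J) (X : Finset J) (k : J),
      #{i | k ∈ Function.update S b X i}
      = (if k ∈ X then 1 else 0) + ∑ i ∈ univ.erase b, if k ∈ S i then 1 else 0 := by
    intro S X k
    rw [hcol, Function.update_self]
    congr 1
    refine sum_congr rfl fun i hi => ?_
    rw [Function.update_of_ne (ne_of_mem_erase hi)]
  refine card_nbij' (fun S => Function.update S b ∅) (fun S => Function.update S b {j}) ?_ ?_ ?_ ?_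
  · intro S hS
    simp only [coe_filter, Set.mem_ofPred_eq] at hS
    obtain ⟨hS, hSb⟩ := hS
    obtain ⟨h1, h2, h3⟩ := mem_rowGraphs.1 hS
    refine mem_coe.2 (mem_rowGraphs.2 ⟨fun i => ?_, fun i => ?_, fun k => ?_⟩)
    · by_cases hib : i = b
      · subst hib; simp
      simp [hib, h1]
    · by_cases hib : i = b
      · subst hib; simp
      simpa [hib] using h2 i
    · have := h3 k
      rw [hcol, hSb] at this
      rw [hcol']
      by_cases hk : k = j
      · subst hk
        simp only [mem_singleton, if_true] at this
        simp only [notMem_empty, if_false, Function.update_self]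
        omega
      · simp only [mem_singleton, hk, if_false] at this
        simp [hk, ← this]
  · intro S hS
    obtain ⟨h1, h2, h3⟩ := mem_rowGraphs.1 (mem_coe.1 hS)
    have hSb : S b = ∅ := by rw [← card_eq_zero, h1]; simp
    simp only [coe_filter, Set.mem_ofPred_eq]
    refine ⟨mem_rowGraphs.2 ⟨fun i => ?_, fun i => ?_, fun k => ?_⟩, by simp⟩
    · by_cases hib : i = b
      · subst hib; simp [hb]
      simp [hib, h1]
    · by_cases hib : i = b
      · subst hib; simp [hF]
      simpa [hib] using h2 i
    · have := h3 k
      rw [hcol, hSb] at this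
      rw [hcol']
      by_cases hk : k = j
      · subst hk
        simp only [notMem_empty, if_false, Function.update_self] at this
        simp only [mem_singleton, if_true]
        omega
      · simp only [notMem_empty, if_false, ne_eq, hk, not_false_eq_true,
          Function.update_of_ne] at this
        simp [hk, ← this]
  · intro S hS
    simp only [coe_filter, Set.mem_ofPred_eq] at hS
    simp [← hS.2]
  · intro S hS
    have hSb : S b = ∅ := by
      rw [← card_eq_zero, (mem_rowGraphs.1 (mem_coe.1 hS)).1]; simp
    simp [← hSb]

lemma sum_update_pred {κ : Type*} [Fintype κ] [DecidableEq κ] {f : κ → ℕ} {k : κ} {m : ℕ}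
    (hk : f k ≠ 0) (hf : ∑ i, f i = m + 1) : ∑ i, Function.update f k (f k - 1) i = m := by
  rw [sum_update_of_mem (mem_univ k)]
  rw [← add_sum_erase univ f (mem_univ k), erase_eq] at hf
  omega

/-- If every row has degree at most one, and no edge at a row of degree one is forbidden, the graphs
are the functions with prescribed fibre sizes, counted by a multinomial coefficient. -/
lemma card_rowGraphs_of_le_one (m : ℕ) : ∀ (δ : ι → ℕ) (Δ : J → ℕ), ∑ i, δ i = m → ∑ j, Δ j = m →
    (∀ i, δ i ≤ 1) → (∀ i, δ i ≠ 0 → F i = ∅) →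
    #(rowGraphs F δ Δ) * ∏ j, (Δ j).factorial = m.factorial := by
  induction m with
  | zero =>
    intro δ Δ h1 h2 _ _
    have e1 : ∀ i, δ i = 0 := by simpa using h1
    have e2 : ∀ j, Δ j = 0 := by simpa using h2
    have : rowGraphs F δ Δ = {fun _ => ∅} := by
      ext S
      rw [mem_rowGraphs, mem_singleton]
      constructor
      · rintro ⟨h, -⟩
        funext i
        rw [← card_eq_zero, h, e1]
      · rintro rfl
        simp [e1, e2]
    simp [this, e2]
  | succ m ih =>
    intro δ Δ h1 h2 h01 hF
    obtain ⟨b, hb⟩ : ∃ b, δ b ≠ 0 := by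
      by_contra! h
      simp [h] at h1
    have hb1 : δ b = 1 := by have := h01 b; omega
    have hcard : #(rowGraphs F δ Δ) = ∑ j, #{S ∈ rowGraphs F δ Δ | S b = {j}} := by
      simp_rw [card_filter]
      rw [sum_comm, card_eq_sum_ones]
      refine sum_congr rfl fun S hS => ?_
      obtain ⟨y, hy⟩ := card_eq_one.1 (((mem_rowGraphs.1 hS).1 b).trans hb1)
      simp [hy]
    have hterm : ∀ j, #{S ∈ rowGraphs F δ Δ | S b = {j}} * ∏ j, (Δ j).factorial
        = Δ j * m.factorial := by
      intro j
      by_cases hj : Δ j = 0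
      · have : #{S ∈ rowGraphs F δ Δ | S b = {j}} = 0 := by
          rw [card_eq_zero, filter_eq_empty_iff]
          intro S hS hSb
          have := (mem_rowGraphs.1 hS).2.2 j
          rw [hj, card_eq_zero, filter_eq_empty_iff] at this
          exact this (mem_univ b) (by simp [hSb])
        simp [this, hj]
      · rw [card_fiber_singleton hb1 (hF b hb) hj]
        have hprod : ∏ k, (Δ k).factorial
            = Δ j * ∏ k, (Function.update Δ j (Δ j - 1) k).factorial := by
          rw [← mul_prod_erase univ _ (mem_univ j),
            ← mul_prod_erase univ (fun k => (Function.update Δ j (Δ j - 1) k).factorial)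
              (mem_univ j), Function.update_self, ← mul_assoc, Nat.mul_factorial_pred hj]
          congr 1
          refine prod_congr rfl fun k hk => ?_
          rw [Function.update_of_ne (ne_of_mem_erase hk)]
        have hδ : ∑ i, Function.update δ b 0 i = m := by
          have := sum_update_pred hb h1
          rwa [hb1] at this
        have := ih (Function.update δ b 0) (Function.update Δ j (Δ j - 1)) hδ
          (sum_update_pred hj h2) ?_ ?_
        · rw [hprod, mul_left_comm, this]
        · intro i
          by_cases hib : i = b
          · subst hib; simp
          simpa [hib] using h01 i
        · intro i
          by_cases hib : i = b
          · subst hib; simp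
          simpa [hib] using hF i
    rw [hcard, sum_mul, sum_congr rfl fun j _ => hterm j, ← sum_mul, h2, Nat.factorial_succ]

end RowModel

section SwitchingEstimates

open Finset

set_option linter.unusedSectionVars false

variable {ι J : Type*} [Fintype ι] [DecidableEq ι] [Fintype J] [DecidableEq J]
  {F : ι → Finset J} {δ : ι → ℕ} {Δ : J → ℕ} {S : ι → Finset J} {m D : ℕ}

/-! ### Edges subject to a local condition -/

lemma sum_edges_mem_column_le (hS : S ∈ rowGraphs F δ Δ) (hΔ : ∀ j, Δ j ≤ D) (X : Finset J) :
    ∑ u, ∑ v ∈ S u, (if v ∈ X then 1 else 0) ≤ D * #X := by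
  rw [sum_edges_column hS]
  calc ∑ v, Δ v * (if v ∈ X then 1 else 0) ≤ ∑ v, D * (if v ∈ X then 1 else 0) :=
        sum_le_sum fun v _ => Nat.mul_le_mul_right _ (hΔ v)
    _ = D * #X := by rw [← mul_sum]; simp

lemma sum_edges_mem_row_le (hS : S ∈ rowGraphs F δ Δ) (hδ : ∀ i, δ i ≤ D) (U : Finset ι) :
    ∑ u, ∑ _v ∈ S u, (if u ∈ U then 1 else 0) ≤ D * #U := by
  rw [sum_edges_row hS]
  calc ∑ u, δ u * (if u ∈ U then 1 else 0) ≤ ∑ u, D * (if u ∈ U then 1 else 0) :=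
        sum_le_sum fun v _ => Nat.mul_le_mul_right _ (hδ v)
    _ = D * #U := by rw [← mul_sum]; simp

lemma sum_edges_const (hS : S ∈ rowGraphs F δ Δ) (hm : ∑ j, Δ j = m) (c : ℕ) :
    ∑ u, ∑ _v ∈ S u, c = m * c := by
  rw [sum_edges_column hS fun _ => c, ← sum_mul, hm]

lemma card_row_union_le (hS : S ∈ rowGraphs F δ Δ) (hδ : ∀ i, δ i ≤ D) (hF : ∀ i, #(F i) ≤ 1)
    (hD : 1 ≤ D) (i : ι) : #(S i ∪ F i) ≤ 2 * D := by
  have h1 := card_union_le (S i) (F i)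
  have h2 := (mem_rowGraphs.1 hS).1 i
  have h3 := hδ i
  have h4 := hF i
  omega

lemma card_column_union_le (hS : S ∈ rowGraphs F δ Δ) (hΔ : ∀ j, Δ j ≤ D)
    (hF : ∀ j, #{i | j ∈ F i} ≤ 1) (hD : 1 ≤ D) (j : J) : #{i | j ∈ S i ∪ F i} ≤ 2 * D := by
  have h1 := card_union_le ({i | j ∈ S i} : Finset ι) ({i | j ∈ F i} : Finset ι)
  rw [← filter_or] at h1
  simp_rw [← mem_union] at h1
  have h2 := (mem_rowGraphs.1 hS).2.2 j
  have h3 := hΔ j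
  have h4 := hF j
  omega

lemma sum_edges_row_union_le (hS : S ∈ rowGraphs F δ Δ) (hδ : ∀ i, δ i ≤ D) (hΔ : ∀ j, Δ j ≤ D)
    (hF : ∀ i, #(F i) ≤ 1) (hD : 1 ≤ D) (i : ι) :
    ∑ u, ∑ v ∈ S u, (if v ∈ S i ∪ F i then 1 else 0) ≤ 2 * D ^ 2 :=
  calc _ ≤ D * #(S i ∪ F i) := sum_edges_mem_column_le hS hΔ _
    _ ≤ D * (2 * D) := Nat.mul_le_mul_left _ (card_row_union_le hS hδ hF hD i)
    _ = 2 * D ^ 2 := by ring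

lemma sum_edges_column_union_le (hS : S ∈ rowGraphs F δ Δ) (hδ : ∀ i, δ i ≤ D)
    (hΔ : ∀ j, Δ j ≤ D) (hF : ∀ j, #{i | j ∈ F i} ≤ 1) (hD : 1 ≤ D) (j : J) :
    ∑ u, ∑ _v ∈ S u, (if j ∈ S u ∪ F u then 1 else 0) ≤ 2 * D ^ 2 :=
  calc _ = ∑ u, ∑ _v ∈ S u, (if u ∈ ({i | j ∈ S i ∪ F i} : Finset ι) then 1 else 0) := by
        simp only [mem_filter, mem_univ, true_and]
    _ ≤ D * #({i | j ∈ S i ∪ F i} : Finset ι) := sum_edges_mem_row_le hS hδ _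
    _ ≤ D * (2 * D) := Nat.mul_le_mul_left _ (card_column_union_le hS hΔ hF hD j)
    _ = 2 * D ^ 2 := by ring

lemma sum_edgePairs_eq_add (G : Finset (ι → Finset J)) (p : ι)
    (φ : (ι → Finset J) × J × ι × J → ℕ) :
    ∑ t ∈ edgePairs G p, φ t = ∑ t ∈ validPairs F G p, φ t
      + ∑ t ∈ edgePairs G p, if t.2.2.2 ∉ t.1 p ∪ F p ∧ t.2.1 ∉ t.1 t.2.2.1 ∪ F t.2.2.1
          then 0 else φ t := by
  rw [validPairs, sum_filter, ← sum_add_distrib]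
  refine sum_congr rfl fun t _ => ?_
  split_ifs <;> simp

lemma sum_validPairs_le (G : Finset (ι → Finset J)) (p : ι)
    (φ : (ι → Finset J) × J × ι × J → ℕ) :
    ∑ t ∈ validPairs F G p, φ t ≤ ∑ t ∈ edgePairs G p, φ t := by
  rw [sum_edgePairs_eq_add (F := F)]; exact Nat.le_add_right _ _

/-- Only `O(D³)` of the pairs in each graph are not valid. -/
lemma sum_edgePairs_invalid_le (hδ : ∀ i, δ i ≤ D) (hΔ : ∀ j, Δ j ≤ D) (hF : ∀ i, #(F i) ≤ 1)
    (hF' : ∀ j, #{i | j ∈ F i} ≤ 1) (hD : 1 ≤ D) (p : ι) :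
    (∑ t ∈ edgePairs (rowGraphs F δ Δ) p,
      if t.2.2.2 ∉ t.1 p ∪ F p ∧ t.2.1 ∉ t.1 t.2.2.1 ∪ F t.2.2.1 then 0 else 1)
      ≤ #(rowGraphs F δ Δ) * (4 * D ^ 3) := by
  rw [sum_edgePairs, ← smul_eq_mul]
  refine sum_le_card_nsmul _ _ _ fun S hS => ?_
  have hp : #(S p) ≤ D := ((mem_rowGraphs.1 hS).1 p).trans_le (hδ p)
  calc _ ≤ ∑ y ∈ S p, 4 * D ^ 2 := ?_
    _ ≤ D * (4 * D ^ 2) := by rw [sum_const, smul_eq_mul]; exact Nat.mul_le_mul_right _ hp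
    _ = 4 * D ^ 3 := by ring
  refine sum_le_sum fun y _ => ?_
  calc _ ≤ ∑ u, ∑ v ∈ S u, ((if v ∈ S p ∪ F p then 1 else 0)
            + (if y ∈ S u ∪ F u then 1 else 0)) := by
        refine sum_le_sum fun u _ => sum_le_sum fun v _ => ?_
        by_cases h1 : v ∈ S p ∪ F p <;> by_cases h2 : y ∈ S u ∪ F u <;> simp only [h1, h2] <;> simp
    _ ≤ 2 * D ^ 2 + 2 * D ^ 2 := by
        simp_rw [sum_add_distrib]
        exact Nat.add_le_add (sum_edges_row_union_le hS hδ hΔ hF hD p)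
          (sum_edges_column_union_le hS hδ hΔ hF' hD y)
    _ = 4 * D ^ 2 := by ring

/-! ### Neighbour weights at a row -/

lemma sum_edgePairs_column_weight (hm : ∑ j, Δ j = m) (a : ι) (w : J → ℕ) :
    ∑ t ∈ edgePairs (rowGraphs F δ Δ) a, w t.2.1
      = m * ∑ S ∈ rowGraphs F δ Δ, ∑ y ∈ S a, w y := by
  rw [sum_edgePairs, mul_sum]
  refine sum_congr rfl fun S hS => ?_
  rw [mul_sum]
  exact sum_congr rfl fun y _ => sum_edges_const hS hm (w y)

lemma sum_edgePairs_partner_weight (a : ι) (w : J → ℕ) :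
    ∑ t ∈ edgePairs (rowGraphs F δ Δ) a, w t.2.2.2
      = #(rowGraphs F δ Δ) * (δ a * ∑ j, Δ j * w j) := by
  rw [sum_edgePairs, ← smul_eq_mul, ← sum_const]
  refine sum_congr rfl fun S hS => ?_
  simp only [sum_edges_column hS]
  rw [sum_const, (mem_rowGraphs.1 hS).1 a, smul_eq_mul]

/-- The total weight of the neighbours of `a`, over all graphs, is what a neighbourhood drawn with
probabilities proportional to the column degrees would give, up to `O(D⁴)` per graph. -/
lemma neighbour_weight_estimate (hδ : ∀ i, δ i ≤ D) (hΔ : ∀ j, Δ j ≤ D) (hF : ∀ i, #(F i) ≤ 1)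
    (hF' : ∀ j, #{i | j ∈ F i} ≤ 1) (hD : 1 ≤ D) (hm : ∑ j, Δ j = m) (a : ι) {w : J → ℕ}
    (hw : ∀ j, w j ≤ D) :
    m * ∑ S ∈ rowGraphs F δ Δ, ∑ y ∈ S a, w y
        ≤ #(rowGraphs F δ Δ) * (δ a * ∑ j, Δ j * w j) + #(rowGraphs F δ Δ) * (4 * D ^ 4) ∧
    #(rowGraphs F δ Δ) * (δ a * ∑ j, Δ j * w j)
        ≤ m * (∑ S ∈ rowGraphs F δ Δ, ∑ y ∈ S a, w y) + #(rowGraphs F δ Δ) * (4 * D ^ 4) := by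
  have hinv : ∀ c : (ι → Finset J) × J × ι × J → J,
      (∑ t ∈ edgePairs (rowGraphs F δ Δ) a,
        if t.2.2.2 ∉ t.1 a ∪ F a ∧ t.2.1 ∉ t.1 t.2.2.1 ∪ F t.2.2.1 then 0 else w (c t))
        ≤ #(rowGraphs F δ Δ) * (4 * D ^ 4) := by
    intro c
    calc _ ≤ ∑ t ∈ edgePairs (rowGraphs F δ Δ) a, D *
          (if t.2.2.2 ∉ t.1 a ∪ F a ∧ t.2.1 ∉ t.1 t.2.2.1 ∪ F t.2.2.1 then 0 else 1) := by
          refine sum_le_sum fun t _ => ?_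
          split_ifs
          · simp
          · simpa using hw _
      _ ≤ D * (#(rowGraphs F δ Δ) * (4 * D ^ 3)) := by
          rw [← mul_sum]
          exact Nat.mul_le_mul_left _ (sum_edgePairs_invalid_le hδ hΔ hF hF' hD a)
      _ = _ := by ring
  have hswitch := sum_validPairs_switch (F := F) (δ := δ) (Δ := Δ) a fun t => w t.2.1
  simp only at hswitch
  rw [← sum_edgePairs_column_weight hm, ← sum_edgePairs_partner_weight]
  constructor
  · rw [sum_edgePairs_eq_add (F := F), hswitch]
    exact Nat.add_le_add (sum_validPairs_le _ _ _) (hinv fun t => t.2.1)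
  · rw [sum_edgePairs_eq_add (F := F), ← hswitch]
    exact Nat.add_le_add (sum_validPairs_le _ _ _) (hinv fun t => t.2.2.2)

/-! ### Collisions with a row of degree one -/

/-- The number of graphs, counted by their edges at `b`, in which a neighbour of `b` is also a
neighbour of `a` or is forbidden for `a`. -/
def collisions (F : ι → Finset J) (G : Finset (ι → Finset J)) (a b : ι) : ℕ :=
  ∑ S ∈ G, ∑ y ∈ S b, if y ∈ S a ∪ F a then 1 else 0

lemma collisions_add_card {b : ι} (hb : δ b = 1) (a : ι) :
    collisions F (rowGraphs F δ Δ) a b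
      + #{S ∈ rowGraphs F δ Δ | Disjoint (S b) (S a ∪ F a)} = #(rowGraphs F δ Δ) := by
  rw [collisions, card_filter, ← sum_add_distrib, card_eq_sum_ones]
  refine sum_congr rfl fun S hS => ?_
  obtain ⟨y, hy⟩ := card_eq_one.1 (((mem_rowGraphs.1 hS).1 b).trans hb)
  have hd : Disjoint (S b) (S a ∪ F a) ↔ y ∉ S a ∪ F a := by rw [hy, disjoint_singleton_left]
  simp only [hd]
  rw [hy, sum_singleton]
  by_cases h : y ∈ S a ∪ F a <;> simp only [h] <;> simp

lemma mul_collisions (hm : ∑ j, Δ j = m) (a b : ι) :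
    m * collisions F (rowGraphs F δ Δ) a b
      = ∑ t ∈ edgePairs (rowGraphs F δ Δ) b, if t.2.1 ∈ t.1 a ∪ F a then 1 else 0 := by
  rw [sum_edgePairs, collisions, mul_sum]
  refine sum_congr rfl fun S hS => ?_
  rw [mul_sum]
  exact sum_congr rfl fun y _ => (sum_edges_const hS hm _).symm

/-- The edges off the row `a` that end in the closed neighbourhood of `a`. -/
lemma sum_edges_off_row (hS : S ∈ rowGraphs F δ Δ) (a : ι) :
    ∑ u, ∑ v ∈ S u, (if u ≠ a ∧ v ∈ S a ∪ F a then 1 else 0)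
      = ∑ j ∈ F a, Δ j + ∑ y ∈ S a, (Δ y - 1) := by
  obtain ⟨-, h2, h3⟩ := mem_rowGraphs.1 hS
  have e1 : ∑ u, ∑ v ∈ S u, (if v ∈ S a ∪ F a then 1 else 0)
      = ∑ j ∈ F a, Δ j + ∑ y ∈ S a, Δ y := by
    rw [sum_edges_column hS]
    simp_rw [mul_ite, mul_one, mul_zero]
    rw [← sum_filter, filter_univ_mem, sum_union (h2 a), add_comm]
  have e2 : ∑ u, ∑ v ∈ S u, (if v ∈ S a ∪ F a then 1 else 0)
      = ∑ u, ∑ v ∈ S u, (if u ≠ a ∧ v ∈ S a ∪ F a then 1 else 0) + #(S a) := by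
    rw [← add_sum_erase univ _ (mem_univ a),
      ← add_sum_erase univ (fun u => ∑ v ∈ S u, (if u ≠ a ∧ v ∈ S a ∪ F a then 1 else 0))
        (mem_univ a)]
    have : ∑ v ∈ S a, (if v ∈ S a ∪ F a then 1 else 0) = #(S a) := by
      rw [card_eq_sum_ones]
      exact sum_congr rfl fun v hv => if_pos (mem_union_left _ hv)
    rw [this]
    have : ∑ v ∈ S a, (if a ≠ a ∧ v ∈ S a ∪ F a then 1 else 0) = 0 := by simp
    rw [this, zero_add, add_comm]
    congr 1
    refine sum_congr rfl fun u hu => sum_congr rfl fun v _ => ?_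
    simp [ne_of_mem_erase hu]
  have e3 : ∑ y ∈ S a, (Δ y - 1) + #(S a) = ∑ y ∈ S a, Δ y := by
    rw [card_eq_sum_ones, ← sum_add_distrib]
    refine sum_congr rfl fun y hy => Nat.sub_add_cancel ?_
    rw [← h3 y]
    exact card_pos.2 ⟨a, by simpa using hy⟩
  omega

/-- After a valid switching at `b`, the new neighbour of `b` collides with `a` exactly if the
second edge of the switching was off the row `a` and ended in the closed neighbourhood of `a`. -/
lemma sum_validPairs_collision {a b : ι} (hab : a ≠ b) :
    (∑ t ∈ validPairs F (rowGraphs F δ Δ) b, if t.2.1 ∈ t.1 a ∪ F a then 1 else 0)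
      = ∑ t ∈ validPairs F (rowGraphs F δ Δ) b,
          if t.2.2.1 ≠ a ∧ t.2.2.2 ∈ t.1 a ∪ F a then 1 else 0 := by
  rw [sum_validPairs_switch b fun t => if t.2.1 ∈ t.1 a ∪ F a then 1 else 0]
  refine sum_congr rfl ?_
  rintro ⟨S, y, u, v⟩ ht
  simp only [validPairs, edgePairs, mem_filter, mem_product, mem_univ, and_true] at ht
  obtain ⟨⟨hS, hy, hv⟩, -, hyu⟩ := ht
  have hyv : y ≠ v := by rintro rfl; exact hyu (mem_union_left _ hv)
  simp only
  by_cases hu : u = a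
  · subst hu
    have := disjoint_left.1 ((mem_rowGraphs.1 hS).2.1 u) hv
    simp [switchEdges_right, hyv.symm, this]
  · simp only [switchEdges_of_ne hab (Ne.symm hu)]
    simp [hu]

lemma sum_edgePairs_off_row {a b : ι} (hb : δ b = 1) :
    (∑ t ∈ edgePairs (rowGraphs F δ Δ) b, if t.2.2.1 ≠ a ∧ t.2.2.2 ∈ t.1 a ∪ F a then 1 else 0)
      = #(rowGraphs F δ Δ) * ∑ j ∈ F a, Δ j
        + ∑ S ∈ rowGraphs F δ Δ, ∑ y ∈ S a, (Δ y - 1) := by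
  rw [sum_edgePairs, ← smul_eq_mul, ← sum_const, ← sum_add_distrib]
  refine sum_congr rfl fun S hS => ?_
  simp only [sum_edges_off_row hS a]
  rw [sum_const, (mem_rowGraphs.1 hS).1 b, hb, one_smul]

/-- Every collision can be switched away in at least `m - 2 D²` ways. -/
lemma collisions_upper (hδ : ∀ i, δ i ≤ D) (hΔ : ∀ j, Δ j ≤ D)
    (hF' : ∀ j, #{i | j ∈ F i} ≤ 1) (hD : 1 ≤ D) (hm : ∑ j, Δ j = m) {a b : ι} (hab : a ≠ b)
    (hb : δ b = 1) (hFb : F b = ∅) :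
    m * collisions F (rowGraphs F δ Δ) a b
      ≤ #(rowGraphs F δ Δ) * ∑ j ∈ F a, Δ j + ∑ S ∈ rowGraphs F δ Δ, ∑ y ∈ S a, (Δ y - 1)
        + 2 * D ^ 2 * collisions F (rowGraphs F δ Δ) a b := by
  rw [mul_collisions hm, sum_edgePairs_eq_add (F := F), sum_validPairs_collision hab,
    ← sum_edgePairs_off_row (a := a) hb]
  refine Nat.add_le_add (sum_validPairs_le _ _ _) ?_
  rw [sum_edgePairs, collisions, mul_sum]
  refine sum_le_sum fun S hS => ?_
  rw [mul_sum]
  refine sum_le_sum fun y hy => ?_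
  by_cases hya : y ∈ S a ∪ F a
  · simp only [hya, if_true, mul_one]
    refine le_trans (sum_le_sum fun u _ => sum_le_sum fun v hv => ?_)
      (sum_edges_column_union_le hS hδ hΔ hF' hD y)
    by_cases hyu : y ∈ S u ∪ F u
    · simp [hyu]
    · have hvb : v ∉ S b ∪ F b := by
        obtain ⟨z, hz⟩ := card_eq_one.1 (((mem_rowGraphs.1 hS).1 b).trans hb)
        rw [hz, mem_singleton] at hy
        subst hy
        rw [hz, hFb]
        simp only [union_empty, mem_singleton]
        rintro rfl
        exact hyu (mem_union_left _ hv)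
      simp only [hyu, hvb, not_false_eq_true, and_self, if_true, if_false, le_refl]
  · simp [hya]

/-- The number of switchings at `b` in which the second edge `(u, v)`, with `u ≠ a, b`, has `v` in
the closed neighbourhood of `a`, but which would create a multiple or forbidden edge at `u`. -/
def obstructions (F : ι → Finset J) (G : Finset (ι → Finset J)) (a b : ι) : ℕ :=
  ∑ S ∈ G, ∑ y ∈ S b, ∑ u, if u = a ∨ u = b then 0 else
    ∑ v ∈ S u, if v ∈ S a ∪ F a ∧ y ∈ S u ∪ F u then 1 else 0

/-- A switching at `b` that would produce a collision is valid, unless its second edge is the edge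
at `b` itself, which needs a collision already, or it is an obstruction. -/
lemma collisions_lower (hm : ∑ j, Δ j = m) {a b : ι} (hab : a ≠ b)
    (hb : δ b = 1) (hFb : F b = ∅) :
    #(rowGraphs F δ Δ) * ∑ j ∈ F a, Δ j + ∑ S ∈ rowGraphs F δ Δ, ∑ y ∈ S a, (Δ y - 1)
      ≤ m * collisions F (rowGraphs F δ Δ) a b + collisions F (rowGraphs F δ Δ) a b
        + obstructions F (rowGraphs F δ Δ) a b := by
  rw [mul_collisions hm, ← sum_edgePairs_off_row (a := a) hb, sum_edgePairs_eq_add (F := F),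
    add_assoc]
  refine Nat.add_le_add ?_ ?_
  · rw [← sum_validPairs_collision hab]
    exact sum_validPairs_le _ _ _
  rw [sum_edgePairs, collisions, obstructions, ← sum_add_distrib]
  refine sum_le_sum fun S hS => ?_
  obtain ⟨z, hz⟩ := card_eq_one.1 (((mem_rowGraphs.1 hS).1 b).trans hb)
  rw [hz]
  simp only [sum_singleton]
  rw [← add_sum_erase univ _ (mem_univ b)]
  refine Nat.add_le_add ?_ ?_
  · rw [hz, sum_singleton]
    by_cases h : z ∈ S a ∪ F a
    · rw [if_pos h]; split_ifs <;> simp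
    · simp [h]
  · rw [← add_sum_erase univ _ (mem_univ b)]
    refine le_trans (sum_le_sum fun u hu => ?_) (Nat.le_add_left _ _)
    have hub : u ≠ b := ne_of_mem_erase hu
    by_cases hua : u = a
    · simp [hua]
    simp only [hua, hub, or_self, if_false]
    refine sum_le_sum fun v hv => ?_
    by_cases hyu : z ∈ S u ∪ F u
    · by_cases hva : v ∈ S a ∪ F a <;> simp only [hyu, hva] <;> simp [hua]
    · have hvb : v ∉ S b ∪ F b := by
        rw [hz, hFb]
        simp only [union_empty, mem_singleton]
        rintro rfl
        exact hyu (mem_union_left _ hv)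
      simp only [hyu, hvb, not_false_eq_true, and_self, if_true, Nat.zero_le]

/-- Obstructions are rare: switching the edge at `b` once more, without touching the rows `a`, `u`,
spreads each of them over almost `m` targets, and each target is hit by few. -/
lemma obstructions_upper (hδ : ∀ i, δ i ≤ D) (hΔ : ∀ j, Δ j ≤ D) (hF : ∀ i, #(F i) ≤ 1)
    (hF' : ∀ j, #{i | j ∈ F i} ≤ 1) (hD : 1 ≤ D) (hm : ∑ j, Δ j = m) {a b : ι} (hab : a ≠ b)
    (hb : δ b = 1) (hFb : F b = ∅) :
    m * obstructions F (rowGraphs F δ Δ) a b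
      ≤ #(rowGraphs F δ Δ) * (4 * D ^ 4)
        + 4 * D ^ 2 * obstructions F (rowGraphs F δ Δ) a b := by
  set φ : (ι → Finset J) × J × ι × J → ℕ := fun t =>
    if t.2.2.1 = a then 0 else ∑ u, if u = a ∨ u = b ∨ u = t.2.2.1 then 0 else
      ∑ v ∈ t.1 u, if v ∈ t.1 a ∪ F a ∧ t.2.1 ∈ t.1 u ∪ F u then 1 else 0 with hφ
  set ψ : (ι → Finset J) × J × ι × J → ℕ := fun t =>
    if t.2.2.1 = a then 0 else ∑ u, if u = a ∨ u = b ∨ u = t.2.2.1 then 0 else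
      ∑ v ∈ t.1 u, if v ∈ t.1 a ∪ F a ∧ t.2.2.2 ∈ t.1 u ∪ F u then 1 else 0 with hψ
  have hswitch : ∑ t ∈ validPairs F (rowGraphs F δ Δ) b, φ t
      = ∑ t ∈ validPairs F (rowGraphs F δ Δ) b, ψ t := by
    rw [sum_validPairs_switch b φ]
    refine sum_congr rfl ?_
    rintro ⟨S, y, u', v'⟩ _
    simp only [hφ, hψ]
    by_cases hu' : u' = a
    · simp [hu']
    simp only [hu', if_false]
    refine sum_congr rfl fun u _ => ?_
    by_cases hu : u = a ∨ u = b ∨ u = u'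
    · simp [hu]
    · simp only [hu, if_false]
      rw [not_or, not_or] at hu
      simp only [switchEdges_of_ne hu.2.1 hu.2.2, switchEdges_of_ne hab (Ne.symm hu')]
  have hψle : ∑ t ∈ edgePairs (rowGraphs F δ Δ) b, ψ t ≤ #(rowGraphs F δ Δ) * (4 * D ^ 4) := by
    rw [sum_edgePairs, ← smul_eq_mul]
    refine sum_le_card_nsmul _ _ _ fun S hS => ?_
    obtain ⟨z, hz⟩ := card_eq_one.1 (((mem_rowGraphs.1 hS).1 b).trans hb)
    rw [hz, sum_singleton]
    simp only [hψ]
    calc _ ≤ ∑ u', ∑ v' ∈ S u', ∑ u, ∑ v ∈ S u,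
          (if v ∈ S a ∪ F a then 1 else 0) * (if v' ∈ S u ∪ F u then 1 else 0) := by
          refine sum_le_sum fun u' _ => sum_le_sum fun v' _ => ?_
          by_cases hu' : u' = a
          · simp [hu']
          rw [if_neg hu']
          refine sum_le_sum fun u _ => ?_
          by_cases hu : u = a ∨ u = b ∨ u = u'
          · simp [hu]
          rw [if_neg hu]
          refine sum_le_sum fun v _ => ?_
          by_cases h1 : v ∈ S a ∪ F a <;> by_cases h2 : v' ∈ S u ∪ F u <;>
            simp only [h1, h2] <;> simp
      _ = ∑ u, ∑ v ∈ S u, (if v ∈ S a ∪ F a then 1 else 0)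
            * ∑ u', ∑ v' ∈ S u', (if v' ∈ S u ∪ F u then 1 else 0) := by
          simp_rw [mul_sum]
          have : ∀ u', ∑ v' ∈ S u', ∑ u, ∑ v ∈ S u,
              (if v ∈ S a ∪ F a then 1 else 0) * (if v' ∈ S u ∪ F u then 1 else 0)
              = ∑ u, ∑ v ∈ S u, ∑ v' ∈ S u',
              (if v ∈ S a ∪ F a then 1 else 0) * (if v' ∈ S u ∪ F u then 1 else 0) := by
            intro u'
            rw [sum_comm]
            exact sum_congr rfl fun u _ => sum_comm
          simp_rw [this]
          rw [sum_comm]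
          exact sum_congr rfl fun u _ => sum_comm
      _ ≤ ∑ u, ∑ v ∈ S u, (if v ∈ S a ∪ F a then 1 else 0) * (2 * D ^ 2) :=
          sum_le_sum fun u _ => sum_le_sum fun v _ =>
            Nat.mul_le_mul_left _ (sum_edges_row_union_le hS hδ hΔ hF hD u)
      _ ≤ (2 * D ^ 2) * (2 * D ^ 2) := by
          simp_rw [← sum_mul]
          exact Nat.mul_le_mul_right _ (sum_edges_row_union_le hS hδ hΔ hF hD a)
      _ = 4 * D ^ 4 := by ring
  have hmain : m * obstructions F (rowGraphs F δ Δ) a b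
      ≤ ∑ t ∈ validPairs F (rowGraphs F δ Δ) b, φ t
        + 4 * D ^ 2 * obstructions F (rowGraphs F δ Δ) a b := by
    rw [validPairs, sum_filter, sum_edgePairs, obstructions, mul_sum, mul_sum, ← sum_add_distrib]
    refine sum_le_sum fun S hS => ?_
    obtain ⟨z, hz⟩ := card_eq_one.1 (((mem_rowGraphs.1 hS).1 b).trans hb)
    simp only [hz, sum_singleton, hφ, hFb, union_empty, mem_singleton]
    -- For a fixed obstruction `(u, v)`, all but `4 D²` of the `m` edges `(u', v')` can be used.
    set B : ι → J → ℕ := fun u v => if v ∈ S a ∪ F a ∧ z ∈ S u ∪ F u then 1 else 0 with hB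
    have hpt : ∀ u' v', v' ∈ S u' →
        (∑ u, if u = a ∨ u = b then 0 else ∑ v ∈ S u, B u v)
        ≤ (if v' ≠ z ∧ z ∉ S u' ∪ F u' then
            if u' = a then 0 else ∑ u, if u = a ∨ u = b ∨ u = u' then 0 else ∑ v ∈ S u, B u v
            else 0)
          + ∑ u, (if u = a ∨ u = b then 0 else ∑ v ∈ S u, B u v)
            * ((if z ∈ S u' ∪ F u' then 1 else 0) + (if u' ∈ ({a, u} : Finset ι) then 1 else 0)) := by
      intro u' v' hv'
      by_cases hz' : z ∈ S u' ∪ F u'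
      · refine le_trans (sum_le_sum fun u _ => ?_) (Nat.le_add_left _ _)
        rw [if_pos hz']
        exact Nat.le_mul_of_pos_right _ (by omega)
      by_cases hu' : u' = a
      · refine le_trans (sum_le_sum fun u _ => ?_) (Nat.le_add_left _ _)
        rw [if_pos (show u' ∈ ({a, u} : Finset ι) by simp [hu'])]
        exact Nat.le_mul_of_pos_right _ (by omega)
      have hne : v' ≠ z := by rintro rfl; exact hz' (mem_union_left _ hv')
      rw [if_pos ⟨hne, hz'⟩, if_neg hu', ← sum_add_distrib]
      refine sum_le_sum fun u _ => ?_
      by_cases huab : u = a ∨ u = b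
      · simp [huab]
      by_cases hu : u = u'
      · subst hu
        rw [if_neg huab]
        refine le_trans ?_ (Nat.le_add_left _ _)
        exact Nat.le_mul_of_pos_right _ (by simp)
      · have : ¬ (u = a ∨ u = b ∨ u = u') := by tauto
        rw [if_neg huab, if_neg this]
        exact Nat.le_add_right _ _
    set K := ∑ u, if u = a ∨ u = b then 0 else ∑ v ∈ S u, B u v with hK
    have hKm : m * K = ∑ u', ∑ v' ∈ S u', K := (sum_edges_const hS hm K).symm
    rw [hKm]
    refine le_trans (sum_le_sum fun u' _ => sum_le_sum fun v' hv' => hpt u' v' hv') ?_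
    simp_rw [sum_add_distrib]
    refine Nat.add_le_add_left ?_ _
    have hcomm : ∑ u', ∑ v' ∈ S u', ∑ u, (if u = a ∨ u = b then 0 else ∑ v ∈ S u, B u v)
            * ((if z ∈ S u' ∪ F u' then 1 else 0) + (if u' ∈ ({a, u} : Finset ι) then 1 else 0))
        = ∑ u, (if u = a ∨ u = b then 0 else ∑ v ∈ S u, B u v) * ∑ u', ∑ v' ∈ S u',
            ((if z ∈ S u' ∪ F u' then 1 else 0) + (if u' ∈ ({a, u} : Finset ι) then 1 else 0)) := by
      simp_rw [mul_sum]
      rw [sum_comm]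
      have : ∀ u', ∑ v' ∈ S u', ∑ u, (if u = a ∨ u = b then 0 else ∑ v ∈ S u, B u v)
            * ((if z ∈ S u' ∪ F u' then 1 else 0) + (if u' ∈ ({a, u} : Finset ι) then 1 else 0))
          = ∑ u, ∑ v' ∈ S u', (if u = a ∨ u = b then 0 else ∑ v ∈ S u, B u v)
            * ((if z ∈ S u' ∪ F u' then 1 else 0) + (if u' ∈ ({a, u} : Finset ι) then 1 else 0)) :=
        fun u' => sum_comm
      simp_rw [this]
    rw [hcomm, hK, mul_sum]
    refine sum_le_sum fun u _ => ?_
    rw [mul_comm]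
    refine Nat.mul_le_mul_right _ ?_
    simp_rw [sum_add_distrib]
    have h1 := sum_edges_column_union_le hS hδ hΔ hF' hD z
    have h2 := sum_edges_mem_row_le hS hδ ({a, u} : Finset ι)
    have h3 : #({a, u} : Finset ι) ≤ 2 := card_le_two
    have h4 : D * #({a, u} : Finset ι) ≤ D * 2 := Nat.mul_le_mul_left _ h3
    have h5 : D ≤ D ^ 2 := Nat.le_self_pow (by norm_num) D
    omega
  calc _ ≤ _ := hmain
    _ ≤ _ := Nat.add_le_add_right (hswitch.le.trans ((sum_validPairs_le _ _ _).trans hψle)) _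

end SwitchingEstimates

section SplittingInduction

open Finset

set_option linter.unusedSectionVars false

variable {ι J : Type*} [Fintype ι] [DecidableEq ι] [Fintype J] [DecidableEq J]
  {F : ι → Finset J} {δ : ι → ℕ} {Δ : J → ℕ} {m D : ℕ}

/-! ### The effect of one split -/

/-- The exponent `-(1/m) ∑ δ_i ∑_{j ∈ F i} Δ_j - (1/(2m²)) ∑ (δ_i)_2 ∑ (Δ_j)_2` of the asymptotic
formula for graphs with forbidden edges `F`. -/
noncomputable def rowExponent (F : ι → Finset J) (m : ℕ) (δ : ι → ℕ) (Δ : J → ℕ) : ℝ :=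
  -(1 / (m : ℝ)) * ∑ i, (δ i : ℝ) * ∑ j ∈ F i, (Δ j : ℝ)
    - 1 / (2 * (m : ℝ) ^ 2)
      * ((∑ i, (δ i : ℝ) * ((δ i : ℝ) - 1)) * ∑ j, (Δ j : ℝ) * ((Δ j : ℝ) - 1))

/-- Arithmetic of the switching estimates: `c / N` is the collision probability, `X / N` the mean
weight of the neighbours of a row of degree `e`, and `β` counts the obstructions. -/
lemma collision_ratio_bound {m D N X c β f e s : ℝ} (hm : 0 < m) (hN : 0 < N) (hD : 1 ≤ D)
    (hmD : 8 * D ^ 2 ≤ m) (hc : 0 ≤ c) (hβ : 0 ≤ β)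
    (hf : f ≤ D) (hX : X ≤ N * D ^ 2)
    (h1 : m * X ≤ N * (e * s) + N * (4 * D ^ 4)) (h2 : N * (e * s) ≤ m * X + N * (4 * D ^ 4))
    (h3 : m * c ≤ N * f + X + 2 * D ^ 2 * c) (h4 : N * f + X ≤ m * c + c + β)
    (h5 : m * β ≤ N * (4 * D ^ 4) + 4 * D ^ 2 * β) :
    c / N ≤ 4 * D ^ 2 / m ∧ |c / N - (f / m + e * s / m ^ 2)| ≤ 16 * D ^ 4 / m ^ 2 := by
  have hDD : D ≤ D ^ 2 := by nlinarith
  have hDD4 : D ^ 2 ≤ D ^ 4 := by nlinarith [sq_nonneg (D ^ 2), sq_nonneg D]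
  -- `8 D² ≤ m` makes `m - 4 D²` and `m - 2 D²` at least `m / 2`.
  have hβm : m * β ≤ 8 * D ^ 4 * N := by nlinarith
  have hfN : N * f ≤ N * D ^ 2 := mul_le_mul_of_nonneg_left (hf.trans hDD) hN.le
  have hcm : m * c ≤ 4 * D ^ 2 * N := by nlinarith
  have e1 : c / N - (f / m + e * s / m ^ 2)
      = (m * (m * c) - m * (N * f) - N * (e * s)) / (N * m ^ 2) := by
    field_simp
    ring
  have hD2c : D ^ 2 * (m * c) ≤ D ^ 2 * (4 * D ^ 2 * N) :=
    mul_le_mul_of_nonneg_left hcm (sq_nonneg D)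
  have hND : N * D ^ 2 ≤ N * D ^ 4 := mul_le_mul_of_nonneg_left hDD4 hN.le
  have h3m := mul_le_mul_of_nonneg_left h3 hm.le
  have h4m := mul_le_mul_of_nonneg_left h4 hm.le
  constructor
  · rw [div_le_div_iff₀ hN hm]
    linarith
  · rw [e1, abs_le]
    constructor
    · rw [← neg_div, div_le_div_iff₀ (by positivity) (by positivity)]
      have : -(16 * D ^ 4 * N) ≤ m * (m * c) - m * (N * f) - N * (e * s) := by nlinarith
      nlinarith [mul_le_mul_of_nonneg_left this (sq_nonneg m)]
    · rw [div_le_div_iff₀ (by positivity) (by positivity)]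
      have : m * (m * c) - m * (N * f) - N * (e * s) ≤ 16 * D ^ 4 * N := by nlinarith [hN, hD2c]
      nlinarith [mul_le_mul_of_nonneg_left this (sq_nonneg m)]

lemma one_sub_eq_exp {q x A B : ℝ} (hq : 0 ≤ q) (hqA : q ≤ A) (hA : A ≤ 1 / 2)
    (hqx : |q - x| ≤ B) : ∃ θ : ℝ, |θ| ≤ B + 2 * A ^ 2 ∧ 1 - q = Real.exp (-x + θ) := by
  refine ⟨Real.log (1 - q) + x, ?_, ?_⟩
  · have h := Real.abs_log_sub_add_sum_range_le (x := q) (by rw [abs_of_nonneg hq]; linarith) 1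
    simp only [range_one, sum_singleton, zero_add, pow_one, Nat.cast_zero, div_one,
      abs_of_nonneg hq] at h
    have h2 : q ^ (1 + 1) / (1 - q) ≤ 2 * A ^ 2 := by
      rw [one_add_one_eq_two, div_le_iff₀ (by linarith)]
      have h1 : q ^ 2 ≤ A ^ 2 := pow_le_pow_left₀ hq hqA 2
      nlinarith [mul_nonneg (sq_nonneg A) (show 0 ≤ 1 / 2 - q by linarith)]
    rw [abs_le] at *
    constructor <;> linarith [h.1, h.2, hqx.1, hqx.2]
  · rw [show -x + (Real.log (1 - q) + x) = Real.log (1 - q) by ring, Real.exp_log (by linarith)]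

/-- The proportion of graphs without a collision between `b` and `a`. -/
lemma card_filter_disjoint_eq_exp (hδ : ∀ i, δ i ≤ D) (hΔ : ∀ j, Δ j ≤ D)
    (hF : ∀ i, #(F i) ≤ 1) (hF' : ∀ j, #{i | j ∈ F i} ≤ 1) (hm : ∑ j, Δ j = m)
    (hmD : 8 * D ^ 2 ≤ m) {a b : ι} (hab : a ≠ b) (hb : δ b = 1) (hFb : F b = ∅)
    (hN : #(rowGraphs F δ Δ) ≠ 0) :
    ∃ θ : ℝ, |θ| ≤ 48 * (D : ℝ) ^ 4 / (m : ℝ) ^ 2 ∧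
      (#{S ∈ rowGraphs F δ Δ | Disjoint (S b) (S a ∪ F a)} : ℝ)
        = #(rowGraphs F δ Δ) * Real.exp (-((∑ j ∈ F a, (Δ j : ℝ)) / m
            + δ a * (∑ j, (Δ j : ℝ) * ((Δ j : ℝ) - 1)) / (m : ℝ) ^ 2) + θ) := by
  have hD : 1 ≤ D := hb ▸ hδ b
  have hm0 : 0 < m := by have := Nat.pow_le_pow_left hD 2; omega
  have hadd := collisions_add_card (F := F) (Δ := Δ) hb a
  obtain ⟨h1, h2⟩ := neighbour_weight_estimate hδ hΔ hF hF' hD hm a (w := fun j => Δ j - 1)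
    fun j => (Nat.sub_le _ _).trans (hΔ j)
  have h3 := collisions_upper hδ hΔ hF' hD hm hab hb hFb
  have h4 := collisions_lower hm hab hb hFb
  have h5 := obstructions_upper hδ hΔ hF hF' hD hm hab hb hFb
  have hf : ∑ j ∈ F a, Δ j ≤ D :=
    (sum_le_card_nsmul _ _ D fun j _ => hΔ j).trans (by simpa using Nat.mul_le_mul_right D (hF a))
  have hX : ∑ S ∈ rowGraphs F δ Δ, ∑ y ∈ S a, (Δ y - 1) ≤ #(rowGraphs F δ Δ) * D ^ 2 := by
    rw [← smul_eq_mul]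
    refine sum_le_card_nsmul _ _ _ fun S hS => ?_
    refine (sum_le_card_nsmul _ _ D fun j _ => (Nat.sub_le _ _).trans (hΔ j)).trans ?_
    rw [smul_eq_mul, sq]
    exact Nat.mul_le_mul_right _ (((mem_rowGraphs.1 hS).1 a).trans_le (hδ a))
  have hs : ((∑ j, Δ j * (Δ j - 1) : ℕ) : ℝ) = ∑ j, (Δ j : ℝ) * ((Δ j : ℝ) - 1) := by
    push_cast
    refine sum_congr rfl fun j _ => ?_
    rcases Nat.eq_zero_or_pos (Δ j) with h | h
    · simp [h]
    · rw [Nat.cast_sub h, Nat.cast_one]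
  rw [← hs, ← Nat.cast_sum]
  generalize collisions F (rowGraphs F δ Δ) a b = c at *
  generalize obstructions F (rowGraphs F δ Δ) a b = β at *
  generalize ∑ S ∈ rowGraphs F δ Δ, ∑ y ∈ S a, (Δ y - 1) = X at *
  generalize ∑ j ∈ F a, Δ j = f at *
  generalize ∑ j, Δ j * (Δ j - 1) = s at *
  generalize #{S ∈ rowGraphs F δ Δ | Disjoint (S b) (S a ∪ F a)} = K at *
  generalize #(rowGraphs F δ Δ) = N at *
  have hNr : (0 : ℝ) < N := by exact_mod_cast Nat.pos_of_ne_zero hN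
  have hmr : (0 : ℝ) < m := by exact_mod_cast hm0
  have hmDr : 8 * (D : ℝ) ^ 2 ≤ m := by exact_mod_cast hmD
  obtain ⟨hq, hqx⟩ := collision_ratio_bound (m := m) (D := D) (N := N) (X := X) (c := c) (β := β)
    (f := f) (e := δ a) (s := s) hmr hNr (by exact_mod_cast hD) hmDr
    (by positivity) (by positivity) (by exact_mod_cast hf) (by exact_mod_cast hX)
    (by exact_mod_cast h1) (by exact_mod_cast h2) (by exact_mod_cast h3) (by exact_mod_cast h4)
    (by exact_mod_cast h5)
  obtain ⟨θ, hθ, he⟩ := one_sub_eq_exp (q := (c : ℝ) / N) (by positivity) hq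
    (by rw [div_le_iff₀ hmr]; linarith) hqx
  refine ⟨θ, hθ.trans (le_of_eq ?_), ?_⟩
  · field_simp
    ring
  · rw [← he]
    have : (c : ℝ) + K = N := by exact_mod_cast hadd
    field_simp
    linarith

lemma splitRow_left {a b : ι} (hab : a ≠ b) : splitRow δ a b a = δ a - 1 := by
  simp [splitRow, hab]

lemma splitRow_right (a b : ι) : splitRow δ a b b = 1 := by simp [splitRow]

lemma splitRow_of_ne {a b i : ι} (ha : i ≠ a) (hb : i ≠ b) : splitRow δ a b i = δ i := by
  simp [splitRow, ha, hb]

/-- Splitting changes a sum over the rows only in the two rows involved. -/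
lemma sum_splitRow {M : Type*} [AddCommGroup M] (f : ι → ℕ → M) {a b : ι} (hab : a ≠ b) :
    ∑ i, f i (splitRow δ a b i)
      = ∑ i, f i (δ i) - f a (δ a) - f b (δ b) + f a (δ a - 1) + f b 1 := by
  have key : ∀ k : ι → M, ∑ i, k i = k a + (k b + ∑ i ∈ (univ.erase a).erase b, k i) := by
    intro k
    rw [← add_sum_erase univ k (mem_univ a),
      ← add_sum_erase (univ.erase a) k (mem_erase.2 ⟨hab.symm, mem_univ b⟩)]
  rw [key fun i => f i (splitRow δ a b i), key fun i => f i (δ i)]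
  have : ∑ i ∈ (univ.erase a).erase b, f i (splitRow δ a b i)
      = ∑ i ∈ (univ.erase a).erase b, f i (δ i) := by
    refine sum_congr rfl fun i hi => ?_
    simp only [mem_erase, mem_univ, and_true] at hi
    rw [splitRow_of_ne hi.2 hi.1]
  rw [this, splitRow_left hab, splitRow_right]
  abel

lemma sum_splitRow_eq {a b : ι} (hab : a ≠ b) (ha : δ a ≠ 0) (hb : δ b = 0) :
    ∑ i, splitRow δ a b i = ∑ i, δ i := by
  have := sum_splitRow (δ := δ) (fun _ k => (k : ℤ)) hab
  rw [hb, Nat.cast_sub (Nat.one_le_iff_ne_zero.2 ha)] at this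
  zify
  rw [this]
  simp

lemma prod_factorial_splitRow {a b : ι} (hab : a ≠ b) (ha : δ a ≠ 0) (hb : δ b = 0) :
    ∏ i, (δ i).factorial = δ a * ∏ i, (splitRow δ a b i).factorial := by
  have key : ∀ k : ι → ℕ, ∏ i, k i = k a * (k b * ∏ i ∈ (univ.erase a).erase b, k i) := by
    intro k
    rw [← mul_prod_erase univ k (mem_univ a),
      ← mul_prod_erase (univ.erase a) k (mem_erase.2 ⟨hab.symm, mem_univ b⟩)]
  rw [key fun i => (δ i).factorial, key fun i => (splitRow δ a b i).factorial]
  have : ∏ i ∈ (univ.erase a).erase b, (splitRow δ a b i).factorial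
      = ∏ i ∈ (univ.erase a).erase b, (δ i).factorial := by
    refine prod_congr rfl fun i hi => ?_
    simp only [mem_erase, mem_univ, and_true] at hi
    rw [splitRow_of_ne hi.2 hi.1]
  rw [this, splitRow_left hab, splitRow_right, hb, ← mul_assoc (δ a), Nat.mul_factorial_pred ha]
  simp

lemma rowExponent_splitRow {a b : ι} (hab : a ≠ b) (ha : δ a ≠ 0) (hb : δ b = 0)
    (hFb : F b = ∅) :
    rowExponent F m δ Δ = rowExponent F m (splitRow δ a b) Δ
      - ((∑ j ∈ F a, (Δ j : ℝ)) / m + ((δ a - 1 : ℕ) : ℝ)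
          * (∑ j, (Δ j : ℝ) * ((Δ j : ℝ) - 1)) / (m : ℝ) ^ 2) := by
  rw [rowExponent, rowExponent,
    sum_splitRow (δ := δ) (fun i k => (k : ℝ) * ∑ j ∈ F i, (Δ j : ℝ)) hab,
    sum_splitRow (δ := δ) (fun _ k => (k : ℝ) * ((k : ℝ) - 1)) hab,
    Nat.cast_sub (Nat.one_le_iff_ne_zero.2 ha), hb, hFb]
  simp only [sum_empty, mul_zero, Nat.cast_zero, zero_mul, sub_zero, add_zero, Nat.cast_one,
    sub_self]
  rcases eq_or_ne (m : ℝ) 0 with hm | hm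
  · simp [hm]
  · field_simp
    ring

/-! ### Splitting all rows -/

/-- Induction over splits: the edges of all rows outside `B` are moved, one by one, to the empty
rows of `B`, until only rows of degree at most one remain. The first argument of `P` counts the
edges still to be moved. -/
lemma split_induction {P : ℕ → (ι → ℕ) → Prop} (B : Finset ι)
    (base : ∀ δ : ι → ℕ, (∀ i ∉ B, δ i = 0) → (∀ b ∈ B, δ b ≤ 1) → ∑ i, δ i = m → P 0 δ)
    (step : ∀ (T : ℕ) (δ : ι → ℕ) (a b : ι), a ∉ B → b ∈ B → δ a ≠ 0 → δ b = 0 → ∑ i, δ i = m →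
      P T (splitRow δ a b) → P (T + 1) δ) :
    ∀ (T : ℕ) (δ : ι → ℕ), ∑ i ∈ Bᶜ, δ i = T → (∀ b ∈ B, δ b ≤ 1) → T ≤ #{b ∈ B | δ b = 0} →
      ∑ i, δ i = m → P T δ := by
  intro T
  induction T with
  | zero =>
    intro δ hT hB _ hm
    exact base δ (fun i hi => sum_eq_zero_iff.1 hT i (mem_compl.2 hi)) hB hm
  | succ T ih =>
    intro δ hT hB hfree hm
    obtain ⟨a, haB, ha⟩ : ∃ a ∈ Bᶜ, δ a ≠ 0 := by
      by_contra! h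
      rw [sum_eq_zero h] at hT
      omega
    obtain ⟨b, hb⟩ := card_pos.1 (Nat.lt_of_lt_of_le T.succ_pos hfree)
    obtain ⟨hbB, hb0⟩ := mem_filter.1 hb
    have haB' := mem_compl.1 haB
    have hab : a ≠ b := by rintro rfl; exact haB' hbB
    refine step T δ a b haB' hbB ha hb0 hm
      (ih (splitRow δ a b) ?_ ?_ ?_ ((sum_splitRow_eq hab ha hb0).trans hm))
    · rw [← add_sum_erase _ _ haB] at hT ⊢
      have : ∑ i ∈ Bᶜ.erase a, splitRow δ a b i = ∑ i ∈ Bᶜ.erase a, δ i := by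
        refine sum_congr rfl fun i hi => ?_
        obtain ⟨hia, hi⟩ := mem_erase.1 hi
        exact splitRow_of_ne hia (by rintro rfl; exact mem_compl.1 hi hbB)
      rw [this, splitRow_left hab]
      omega
    · intro c hc
      by_cases hcb : c = b
      · rw [hcb, splitRow_right]
      · rw [splitRow_of_ne (by rintro rfl; exact haB' hc) hcb]
        exact hB c hc
    · have : ({c ∈ B | δ c = 0} : Finset ι).erase b ⊆ {c ∈ B | splitRow δ a b c = 0} := by
        intro c hc
        obtain ⟨hcb, hc⟩ := mem_erase.1 hc
        obtain ⟨hcB, hc0⟩ := mem_filter.1 hc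
        refine mem_filter.2 ⟨hcB, ?_⟩
        rw [splitRow_of_ne (by rintro rfl; exact haB' hcB) hcb, hc0]
      have h := card_le_card this
      rw [card_erase_of_mem hb] at h
      omega

/-- Once all edges lie at rows of `B` of degree one, the configuration count is exact. -/
lemma card_rowGraphs_of_spare (B : Finset ι) (hFB : ∀ b ∈ B, F b = ∅) (hm : ∑ j, Δ j = m)
    (h0 : ∀ i ∉ B, δ i = 0) (h1 : ∀ b ∈ B, δ b ≤ 1) (hδ : ∑ i, δ i = m) :
    #(rowGraphs F δ Δ) * ((∏ i, (δ i).factorial) * ∏ j, (Δ j).factorial) = m.factorial := by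
  have hle : ∀ i, δ i ≤ 1 := fun i => by
    by_cases hi : i ∈ B
    · exact h1 i hi
    · simp [h0 i hi]
  have hprod : ∏ i, (δ i).factorial = 1 :=
    prod_eq_one fun i _ => Nat.factorial_eq_one.2 (hle i)
  rw [hprod, one_mul]
  refine card_rowGraphs_of_le_one m δ Δ hδ hm hle fun i hi => hFB i ?_
  by_contra h
  exact hi (h0 i h)

theorem card_rowGraphs_le (B : Finset ι) (hFB : ∀ b ∈ B, F b = ∅) (hB : ∀ b ∈ B, δ b = 0)
    (hBm : #B = m) (hδ : ∑ i, δ i = m) (hΔ : ∑ j, Δ j = m) :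
    #(rowGraphs F δ Δ) * ((∏ i, (δ i).factorial) * ∏ j, (Δ j).factorial) ≤ m.factorial := by
  refine split_induction (m := m) (P := fun _ δ => #(rowGraphs F δ Δ)
      * ((∏ i, (δ i).factorial) * ∏ j, (Δ j).factorial) ≤ m.factorial) B
    (fun δ h0 h1 hs => (card_rowGraphs_of_spare B hFB hΔ h0 h1 hs).le) ?_ m δ ?_ ?_ ?_ hδ
  · intro _ δ a b haB hbB ha hb _ ih
    have hab : a ≠ b := by rintro rfl; exact haB hbB
    refine le_trans ?_ ih
    rw [prod_factorial_splitRow hab ha hb, mul_assoc, mul_left_comm, ← mul_assoc,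
      ← card_filter_splitRow hab ha hb (hFB b hbB)]
    exact Nat.mul_le_mul_right _ (card_filter_le _ _)
  · rw [← hδ, ← sum_add_sum_compl B, sum_eq_zero hB, zero_add]
  · intro b hb
    simp [hB b hb]
  · rw [filter_true_of_mem hB, hBm]

/-- Each of the `m` splits contributes an error of at most `48 D⁴ / m²` to the exponent. -/
theorem card_rowGraphs_asymptotic (B : Finset ι) (hFB : ∀ b ∈ B, F b = ∅)
    (hB : ∀ b ∈ B, δ b = 0) (hBm : #B = m) (hδ : ∑ i, δ i = m) (hΔ : ∑ j, Δ j = m)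
    (hF : ∀ i, #(F i) ≤ 1) (hF' : ∀ j, #{i | j ∈ F i} ≤ 1) (hδD : ∀ i, δ i ≤ D)
    (hΔD : ∀ j, Δ j ≤ D) (hmD : 8 * D ^ 2 ≤ m) :
    ∃ θ : ℝ, |θ| ≤ 48 * ((D : ℝ) ^ 4 / m) ∧
      (#(rowGraphs F δ Δ) : ℝ) * ((∏ i, (δ i).factorial : ℕ) * (∏ j, (Δ j).factorial : ℕ))
        = m.factorial * Real.exp (rowExponent F m δ Δ + θ) := by
  refine Exists.imp ?_ (split_induction (m := m)
    (P := fun T δ => (∀ i, δ i ≤ D) → ∃ θ : ℝ, |θ| ≤ T * (48 * (D : ℝ) ^ 4 / (m : ℝ) ^ 2) ∧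
      (#(rowGraphs F δ Δ) : ℝ) * ((∏ i, (δ i).factorial : ℕ) * (∏ j, (Δ j).factorial : ℕ))
        = m.factorial * Real.exp (rowExponent F m δ Δ + θ)) B ?_ ?_ m δ ?_ ?_ ?_ hδ hδD)
  · rintro θ ⟨hθ, h⟩
    refine ⟨hθ.trans (le_of_eq ?_), h⟩
    rcases eq_or_ne (m : ℝ) 0 with hm | hm
    -- for `m = 0` both sides are quotients by zero
    · simp [hm]
    · field_simp
  · intro δ h0 h1 hs _
    refine ⟨0, by simp, ?_⟩
    have e0 : rowExponent F m δ Δ = 0 := by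
      have t1 : ∑ i, (δ i : ℝ) * ∑ j ∈ F i, (Δ j : ℝ) = 0 := sum_eq_zero fun i _ => by
        by_cases hi : i ∈ B
        · simp [hFB i hi]
        · simp [h0 i hi]
      have t2 : ∑ i, (δ i : ℝ) * ((δ i : ℝ) - 1) = 0 := sum_eq_zero fun i _ => by
        by_cases hi : i ∈ B
        · have := h1 i hi
          interval_cases δ i <;> simp
        · simp [h0 i hi]
      simp [rowExponent, t1, t2]
    rw [e0, add_zero, Real.exp_zero, mul_one]
    exact_mod_cast card_rowGraphs_of_spare B hFB hΔ h0 h1 hs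
  · intro T δ a b haB hbB ha hb _ ih hD
    have hab : a ≠ b := by rintro rfl; exact haB hbB
    have hD' : ∀ i, splitRow δ a b i ≤ D := by
      intro i
      by_cases hib : i = b
      · rw [hib, splitRow_right]
        exact (Nat.one_le_iff_ne_zero.2 ha).trans (hD a)
      by_cases hia : i = a
      · rw [hia, splitRow_left hab]
        exact (Nat.sub_le _ _).trans (hD a)
      rw [splitRow_of_ne hia hib]
      exact hD i
    obtain ⟨θ, hθ, hih⟩ := ih hD'
    -- The right-hand side of the induction hypothesis is positive, so some graph exists.
    have hN : #(rowGraphs F (splitRow δ a b) Δ) ≠ 0 := by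
      intro h
      rw [h, Nat.cast_zero, zero_mul] at hih
      have : (0 : ℝ) < m.factorial * Real.exp (rowExponent F m (splitRow δ a b) Δ + θ) := by
        positivity
      exact this.ne hih
    obtain ⟨θ', hθ', hs⟩ := card_filter_disjoint_eq_exp hD' hΔD hF hF' hΔ hmD hab
      (splitRow_right a b) (hFB b hbB) hN
    rw [card_filter_splitRow hab ha hb (hFB b hbB), splitRow_left hab] at hs
    refine ⟨θ + θ', ?_, ?_⟩
    · refine (abs_add_le _ _).trans ?_
      push_cast
      linarith
    · rw [prod_factorial_splitRow hab ha hb, rowExponent_splitRow hab ha hb (hFB b hbB)]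
      push_cast at hs hih ⊢
      calc _ = ((δ a : ℝ) * #(rowGraphs F δ Δ))
            * ((∏ i, ((splitRow δ a b i).factorial : ℝ)) * ∏ j, ((Δ j).factorial : ℝ)) := by ring
        _ = (#(rowGraphs F (splitRow δ a b) Δ)
            * ((∏ i, ((splitRow δ a b i).factorial : ℝ)) * ∏ j, ((Δ j).factorial : ℝ)))
            * Real.exp (-((∑ j ∈ F a, (Δ j : ℝ)) / m + ((δ a - 1 : ℕ) : ℝ)
              * (∑ j, (Δ j : ℝ) * ((Δ j : ℝ) - 1)) / (m : ℝ) ^ 2) + θ') := by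
            rw [hs]; ring
        _ = _ := by
            rw [hih, mul_assoc, ← Real.exp_add]
            congr 2
            ring
  · rw [← hδ, ← sum_add_sum_compl B, sum_eq_zero hB, zero_add]
  · intro b hb
    simp [hB b hb]
  · rw [filter_true_of_mem hB, hBm]

end SplittingInduction

section Digraphs

open Finset

/-! ### Digraphs as in-neighbourhoods -/

/-- The forbidden edges of digraphs: no loops, and nothing forbidden at the `m` spare rows. -/
def loopEdges (n m : ℕ) : Fin n ⊕ Fin m → Finset (Fin n) :=
  Sum.elim (fun v => {v}) fun _ => ∅

/-- The in-degrees, extended by zero to the spare rows. -/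
def spareDegrees (m : ℕ) {n : ℕ} (δ : Fin n → ℕ) : Fin n ⊕ Fin m → ℕ :=
  Sum.elim δ fun _ => 0

lemma card_filter_sum_elim {n m : ℕ} (f : Fin n → Finset (Fin n)) (v : Fin n) :
    #{i : Fin n ⊕ Fin m | v ∈ (Sum.elim f fun _ => ∅ : Fin n ⊕ Fin m → Finset (Fin n)) i}
      = #{w | v ∈ f w} := by
  rw [card_filter, card_filter, Fintype.sum_sum_type]
  simp only [Sum.elim_inl, Sum.elim_inr, notMem_empty, if_false, sum_const_zero, add_zero]
  exact sum_congr rfl fun i _ => if_congr Iff.rfl rfl rfl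

lemma simpleDigraphCount_eq (m : ℕ) {n : ℕ} (δ Δ : Fin n → ℕ) :
    simpleDigraphCount δ Δ = #(rowGraphs (loopEdges n m) (spareDegrees m δ) Δ) := by
  classical
  rw [simpleDigraphCount, ← Set.ncard_coe_finset]
  have hin : ∀ (G : Digraph (Fin n)) (v : Fin n), G.inDeg v = #{u | G.Adj u v} := by
    intro G v
    rw [Digraph.inDeg, ← Set.ncard_coe_finset, coe_filter_univ]
  have hout : ∀ (G : Digraph (Fin n)) (v : Fin n), G.outDeg v = #{u | G.Adj v u} := by
    intro G v
    rw [Digraph.outDeg, ← Set.ncard_coe_finset, coe_filter_univ]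
  refine Set.ncard_congr
    (fun G _ => Sum.elim (fun v => ({u | G.Adj u v} : Finset (Fin n))) fun _ => ∅) ?_ ?_ ?_
  · rintro G ⟨h1, h2, h3⟩
    refine mem_coe.2 (mem_rowGraphs.2 ⟨?_, ?_, fun j => ?_⟩)
    · rintro (v | v)
      · simp [spareDegrees, ← h2 v, hin]
      · simp [spareDegrees]
    · rintro (v | v)
      · simp [loopEdges, h1 v]
      · simp [loopEdges]
    · rw [card_filter_sum_elim, ← h3 j, hout]
      simp
  · intro G H _ _ h
    ext u v
    have := congrArg (u ∈ ·) (congrFun h (Sum.inl v))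
    simpa using this
  · intro S hS
    obtain ⟨h1, h2, h3⟩ := mem_rowGraphs.1 (mem_coe.1 hS)
    have hSe : S = Sum.elim (fun v => S (Sum.inl v)) fun _ => ∅ := by
      funext i
      rcases i with v | v
      · rfl
      · rw [Sum.elim_inr, ← card_eq_zero, h1]
        rfl
    refine ⟨⟨fun u v => u ∈ S (Sum.inl v)⟩, ⟨fun v => ?_, fun v => ?_, fun v => ?_⟩, ?_⟩
    · simpa [loopEdges] using h2 (Sum.inl v)
    · rw [hin]
      simpa [spareDegrees] using h1 (Sum.inl v)
    · rw [hout, ← h3 v]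
      conv_rhs => rw [hSe]
      rw [card_filter_sum_elim]
      congr 1
      ext w
      simp
    · conv_rhs => rw [hSe]
      simp

variable {n m : ℕ} {δ Δ : Fin n → ℕ}

lemma sum_spareDegrees : ∑ i, spareDegrees m δ i = ∑ i, δ i := by
  simp [Fintype.sum_sum_type, spareDegrees]

lemma prod_factorial_spareDegrees :
    ∏ i, (spareDegrees m δ i).factorial = ∏ i, (δ i).factorial := by
  simp [Fintype.prod_sum_type, spareDegrees]

lemma rowExponent_loopEdges :
    rowExponent (loopEdges n m) m (spareDegrees m δ) Δ = mainExponent m δ Δ := by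
  simp [rowExponent, mainExponent, loopEdges, spareDegrees, Fintype.sum_sum_type]

/-- The spare rows. -/
def spareRows (n m : ℕ) : Finset (Fin n ⊕ Fin m) := univ.map Function.Embedding.inr

lemma spareRows_spec {b : Fin n ⊕ Fin m} (hb : b ∈ spareRows n m) :
    loopEdges n m b = ∅ ∧ spareDegrees m δ b = 0 := by
  obtain ⟨k, -, rfl⟩ := mem_map.1 hb
  exact ⟨rfl, rfl⟩

lemma card_spareRows : #(spareRows n m) = m := by simp [spareRows]

lemma mainFactor_eq : mainFactor m δ Δ
    = m.factorial / ((∏ i, (δ i).factorial : ℕ) * (∏ i, (Δ i).factorial : ℕ)) := by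
  rw [mainFactor, prod_div_distrib, prod_mul_distrib]
  push_cast
  simp [div_eq_mul_inv]

lemma card_loopEdges_le (i : Fin n ⊕ Fin m) : #(loopEdges n m i) ≤ 1 := by
  rcases i with v | v <;> simp [loopEdges]

lemma card_loopEdges_column_le (j : Fin n) : #{i | j ∈ loopEdges n m i} ≤ 1 := by
  rw [loopEdges, card_filter_sum_elim]
  refine card_le_one.2 fun u hu w hw => ?_
  simp only [mem_filter, mem_univ, true_and, mem_singleton] at hu hw
  exact hu.symm.trans hw

lemma prod_factorial_pos : (0 : ℝ) < (∏ i, (δ i).factorial : ℕ) * (∏ i, (Δ i).factorial : ℕ) := by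
  have h : ∀ f : Fin n → ℕ, 0 < ∏ i, (f i).factorial := fun f => prod_pos fun i _ =>
    Nat.factorial_pos _
  exact_mod_cast Nat.mul_pos (h δ) (h Δ)

theorem simpleDigraphCount_le (hδ : ∑ i, δ i = m) (hΔ : ∑ i, Δ i = m) :
    (simpleDigraphCount δ Δ : ℝ) ≤ mainFactor m δ Δ := by
  have h := card_rowGraphs_le (F := loopEdges n m) (δ := spareDegrees m δ) (Δ := Δ) (m := m)
    (spareRows n m) (fun b hb => (spareRows_spec (δ := δ) hb).1)
    (fun b hb => (spareRows_spec hb).2) card_spareRows (sum_spareDegrees.trans hδ) hΔ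
  rw [← simpleDigraphCount_eq, prod_factorial_spareDegrees] at h
  rw [mainFactor_eq, le_div_iff₀ prod_factorial_pos]
  exact_mod_cast h

theorem simpleDigraphCount_asymptotic (hδ : ∑ i, δ i = m) (hΔ : ∑ i, Δ i = m)
    (hmD : 8 * maxDegree δ Δ ^ 2 ≤ m) :
    ∃ θ : ℝ, |θ| ≤ 48 * ((maxDegree δ Δ : ℝ) ^ 4 / m) ∧
      (simpleDigraphCount δ Δ : ℝ)
        = mainFactor m δ Δ * Real.exp (mainExponent m δ Δ + θ) := by
  have hδD : ∀ i, spareDegrees m δ i ≤ maxDegree δ Δ := by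
    rintro (v | v)
    · exact (le_sup (f := δ) (mem_univ v)).trans (le_max_left _ _)
    · exact Nat.zero_le _
  obtain ⟨θ, hθ, h⟩ := card_rowGraphs_asymptotic (F := loopEdges n m) (δ := spareDegrees m δ)
    (Δ := Δ) (m := m) (D := maxDegree δ Δ)
    (spareRows n m) (fun b hb => (spareRows_spec (δ := δ) hb).1)
    (fun b hb => (spareRows_spec hb).2) card_spareRows (sum_spareDegrees.trans hδ) hΔ
    card_loopEdges_le card_loopEdges_column_le hδD
    (fun j => (le_sup (f := Δ) (mem_univ j)).trans (le_max_right _ _)) hmD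
  refine ⟨θ, hθ, ?_⟩
  rw [← simpleDigraphCount_eq, prod_factorial_spareDegrees, rowExponent_loopEdges] at h
  rw [mainFactor_eq, div_mul_eq_mul_div, eq_div_iff prod_factorial_pos.ne', h]

lemma eight_mul_sq_le {d m : ℕ} (h : (d : ℝ) ≤ 1 / 2 * (m : ℝ) ^ (1 / 4 : ℝ)) :
    8 * d ^ 2 ≤ m := by
  have h4 : (d : ℝ) ^ 4 ≤ (1 / 2 * (m : ℝ) ^ (1 / 4 : ℝ)) ^ 4 :=
    pow_le_pow_left₀ (Nat.cast_nonneg d) h 4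
  have hm : ((m : ℝ) ^ (1 / 4 : ℝ)) ^ 4 = m := by
    rw [← Real.rpow_natCast, ← Real.rpow_mul (Nat.cast_nonneg m)]
    norm_num
  rw [mul_pow, hm] at h4
  have h16 : 16 * d ^ 4 ≤ m := by
    have : 16 * (d : ℝ) ^ 4 ≤ m := by linarith
    exact_mod_cast this
  have : d ^ 2 ≤ d ^ 4 := by
    rcases Nat.eq_zero_or_pos d with rfl | hd
    · simp
    · exact Nat.pow_le_pow_right hd (by norm_num)
  omega

end Digraphs

theorem theorem1p1 :
    -- the fudge factor `g(δ, Δ) / (m! ∏ 1 / (δ_i! Δ_i!))` is always at most one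
    (∀ (n m : ℕ) (δ Δ : Fin n → ℕ), ∑ i, δ i = m → ∑ i, Δ i = m →
      (simpleDigraphCount δ Δ : ℝ) ≤ mainFactor m δ Δ) ∧
    -- the asymptotic formula, with one absolute constant `C` in the remainder `O(D⁴ / m)`
    (∃ C : ℝ, 0 < C ∧
      ∀ (n m : ℕ → ℕ) (δ Δ : (k : ℕ) → Fin (n k) → ℕ),
        (∀ k, ∑ i, δ k i = m k) → (∀ k, ∑ i, Δ k i = m k) → (∀ k, n k ≤ m k) →
        ((fun k => (maxDegree (δ k) (Δ k) : ℝ)) =o[atTop] fun k => (m k : ℝ) ^ (1 / 4 : ℝ)) →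
        ∀ᶠ k in atTop, ∃ θ : ℝ,
          |θ| ≤ C * ((maxDegree (δ k) (Δ k) : ℝ) ^ 4 / (m k : ℝ)) ∧
          (simpleDigraphCount (δ k) (Δ k) : ℝ)
            = mainFactor (m k) (δ k) (Δ k) * Real.exp (mainExponent (m k) (δ k) (Δ k) + θ)) := by
  -- `48 = 16 + 2 * 4²`: the switching error and the second-order term of `log (1 - q)`.
  refine ⟨fun n m δ Δ => simpleDigraphCount_le, 48, by norm_num, ?_⟩
  intro n m δ Δ hδ hΔ _ ho
  filter_upwards [ho.bound (show (0 : ℝ) < 1 / 2 by norm_num)] with k hk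
  refine simpleDigraphCount_asymptotic (hδ k) (hΔ k) (eight_mul_sq_le ?_)
  rwa [Real.norm_of_nonneg (Nat.cast_nonneg _),
    Real.norm_of_nonneg (Real.rpow_nonneg (Nat.cast_nonneg _) _)] at hk
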